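/- Let $x_1,\dots,x_n\in\mathbb R^d$ with $\|x_i\|_2=1$ and $y_1,\dots,y_n\in[-1,1]$ be training data. Consider the two-layer ReLU network of width $m$, $f(x;W)=\frac1{\sqrt m}\sum_{r=1}^m a_r\,\sigma(w_r^\top x)$ with $\sigma(z)=\max(z,0)$ and $W=(w_1,\dots,w_m)\in(\mathbb R^d)^m$, initialized with $w_r(0)\sim\mathcal N(0,\kappa^2 I_d)$ and $a_r\sim\mathrm{unif}\{-1,1\}$, all independent. The $a_r$ stay fixed, and $W$ is trained by the gradient flow $\frac{dW}{dt}\in-\partial\mathcal L(W(t))$ of the ridge-regularized loss $$\mathcal L(W)=\tfrac12\sum_{i=1}^n\big(f(x_i;W)-y_i\big)^2+\tfrac\lambda2\|W-W(0)\|_F^2 .$$ Here a gradient flow is a locally absolutely continuous curve on $[0,\infty)$ starting at $W(0)$ that for almost every $t$ satisfies $$\frac{dw_r}{dt}=\sum_{i=1}^n\big(y_i-f(x_i;W(t))\big)\frac{a_r}{\sqrt m}\,g_{ri}(t)\,x_i-\lambda\,(w_r(t)-w_r(0)),\qquad r=1,\dots,m,$$ where $g_{ri}(t)=1$ if $w_r(t)^\top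 x_i>0$, $g_{ri}(t)=0$ if $w_r(t)^\top x_i<0$, and $g_{ri}(t)\in[0,1]$ if $w_r(t)^\top x_i=0$. Let $$K^\infty(x,x')=\mathbb E_{w\sim\mathcal N(0,I_d)}\big[x^\top x'\,\mathbb I\{w^\top x\ge0,\ w^\top x'\ge0\}\big]$$ be the neural tangent kernel, and let $f_{ntk}(x)=(K^\infty_x)^\top(K^\infty_{tr}+\lambda I_n)^{-1}y$ be its kernel ridge regression predictor, where $[K^\infty_x]_i=K^\infty(x,x_i)$ and $[K^\infty_{tr}]_{ij}=K^\infty(x_i,x_j)$. Theorem. For all constants $c_1,c_2>0$ there is a constant $C>0$, depending only on $c_1$ and $c_2$, such that the following holds for all $d,n,m$, all such training data, and all $\lambda,\kappa,\epsilon,\delta$ with $0<\lambda<\sqrt n$, $\epsilon>0$, $0<\delta<1$, $0<\kappa\le1$, $$\kappa\le c_1\,\frac{\sqrt\delta\,\lambda\,\epsilon}{n},\qquad m\ge c_2\,\frac{n^8}{\kappa^2\epsilon^2\delta^4\lambda^6}.$$ For every $x_{te}\in\mathbb R^d$ with $\|x_{te}\|_2=1$, with probability at least $1-\delta$ over the initialization,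 a gradient flow exists, and for every gradient flow $W$ the limit $f_{nn}(x_{te})=\lim_{t\to\infty}f(x_{te};W(t))$ exists and satisfies $$|f_{nn}(x_{te})-f_{ntk}(x_{te})|\le C\,\epsilon .$$ -/

import Mathlib

open MeasureTheory ProbabilityTheory Filter Topology
open scoped RealInnerProductSpace

namespace WideNet

/-- The first-layer weights `w_1, …, w_m ∈ ℝ^d`. -/
abbrev Weights (m d : ℕ) : Type := Fin m → EuclideanSpace ℝ (Fin d)

/-- The ReLU activation. -/
def relu (z : ℝ) : ℝ := max z 0

/-- The (convex, equivalently Clarke) subdifferential of the ReLU: the derivative away from `0`,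
and the whole interval `[0, 1]` at the kink. -/
def reluSubdiff (z : ℝ) : Set ℝ :=
  {g | 0 ≤ g ∧ g ≤ 1 ∧ (0 < z → g = 1) ∧ (z < 0 → g = 0)}

/-- The convention `σ'(z) = 𝟙{z ≥ 0}` is one of the admissible choices. -/
lemma indicator_mem_reluSubdiff (z : ℝ) : (if 0 ≤ z then (1 : ℝ) else 0) ∈ reluSubdiff z := by
  by_cases h : 0 ≤ z
  · simp [reluSubdiff, h, not_lt.2 h]
  · simp [reluSubdiff, h, (not_le.1 h).le]

variable {n m d : ℕ}

/-- The two-layer network `f(x; W) = m^{-1/2} ∑_r a_r σ(w_r ⬝ x)`. -/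
noncomputable def network (a : Fin m → ℝ) (W : Weights m d) (x : EuclideanSpace ℝ (Fin d)) : ℝ :=
  (1 / Real.sqrt m) * ∑ r, a r * relu ⟪W r, x⟫

/-- The ridge-regularized square loss
`½ ∑_i (f(x_i; W) - y_i)² + (λ/2) ‖W - W₀‖_F²`. -/
noncomputable def loss (X : Fin n → EuclideanSpace ℝ (Fin d)) (y : Fin n → ℝ) (lam : ℝ)
    (a : Fin m → ℝ) (W₀ W : Weights m d) : ℝ :=
  (1 / 2) * ∑ i, (network a W (X i) - y i) ^ 2 + (lam / 2) * ∑ r, ‖W r - W₀ r‖ ^ 2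

/-- The partial (generalized) gradient of the loss in `w_r` given by the chain rule, where `g r i`
is the value used for `σ'(w_r ⬝ x_i)`. -/
noncomputable def lossGrad (X : Fin n → EuclideanSpace ℝ (Fin d)) (y : Fin n → ℝ) (lam : ℝ)
    (a : Fin m → ℝ) (W₀ W : Weights m d) (g : Fin m → Fin n → ℝ) : Weights m d :=
  fun r => ∑ i, ((network a W (X i) - y i) * ((1 / Real.sqrt m) * a r * g r i)) • X i
    + lam • (W r - W₀ r)

/-- The generalized gradients of the loss at `W`: all those obtained by the chain rule from
elements of the subdifferential of the ReLU. -/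
def lossSubgrad (X : Fin n → EuclideanSpace ℝ (Fin d)) (y : Fin n → ℝ) (lam : ℝ)
    (a : Fin m → ℝ) (W₀ W : Weights m d) : Set (Weights m d) :=
  {G | ∃ g : Fin m → Fin n → ℝ, (∀ r i, g r i ∈ reluSubdiff ⟪W r, X i⟫) ∧
    G = lossGrad X y lam a W₀ W g}

/-- `W : [0, ∞) → ℝ^{m × d}` is a gradient flow of the loss started at `W₀`: it is locally
absolutely continuous, and `dW/dt ∈ -∂L(W(t))` for almost every `t ≥ 0`. -/
structure IsGradientFlow (X : Fin n → EuclideanSpace ℝ (Fin d)) (y : Fin n → ℝ) (lam : ℝ)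
    (a : Fin m → ℝ) (W₀ : Weights m d) (W : ℝ → Weights m d) : Prop where
  init : W 0 = W₀
  absCont : ∀ T : ℝ, 0 < T → AbsolutelyContinuousOnInterval W 0 T
  flow : ∀ᵐ t ∂(volume.restrict (Set.Ioi (0 : ℝ))),
    ∃ G ∈ lossSubgrad X y lam a W₀ (W t), HasDerivAt W (-G) t

lemma hasDerivAt_relu {z g : ℝ} (hz : z ≠ 0) (hg : g ∈ reluSubdiff z) : HasDerivAt relu g z := by
  rcases lt_or_gt_of_ne hz with h | h
  · rw [hg.2.2.2 h]
    refine (hasDerivAt_const z (0 : ℝ)).congr_of_eventuallyEq ?_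
    filter_upwards [Iio_mem_nhds h] with t ht using max_eq_right (le_of_lt ht)
  · rw [hg.2.2.1 h]
    refine (hasDerivAt_id z).congr_of_eventuallyEq ?_
    filter_upwards [Ioi_mem_nhds h] with t ht using max_eq_left (le_of_lt ht)

/-- Where no pre-activation on the training data vanishes, `lossSubgrad` is the ordinary gradient
of the loss. -/
lemma hasFDerivAt_loss (X : Fin n → EuclideanSpace ℝ (Fin d)) (y : Fin n → ℝ) (lam : ℝ)
    (a : Fin m → ℝ) (W₀ W G : Weights m d) (hW : ∀ r i, ⟪W r, X i⟫ ≠ 0)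
    (hG : G ∈ lossSubgrad X y lam a W₀ W) :
    HasFDerivAt (loss X y lam a W₀)
      (∑ r, (innerSL ℝ (G r)).comp (ContinuousLinearMap.proj (R := ℝ) r)) W := by
  obtain ⟨g, hg, rfl⟩ := hG
  have hpr : ∀ r, HasFDerivAt (fun V : Weights m d => V r)
      (ContinuousLinearMap.proj (R := ℝ) (φ := fun _ => EuclideanSpace ℝ (Fin d)) r) W :=
    fun r => hasFDerivAt_apply r W
  have hnet : ∀ i, HasFDerivAt (fun V : Weights m d => network a V (X i)) _ W := fun i =>
    (HasFDerivAt.fun_sum fun r _ =>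
      ((hasDerivAt_relu (hW r i) (hg r i)).comp_hasFDerivAt W
        ((hpr r).inner ℝ (hasFDerivAt_const (X i) W))).const_mul (a r)).const_mul
          (1 / Real.sqrt m)
  have h1 := ((HasFDerivAt.fun_sum fun i (_ : i ∈ Finset.univ) =>
      ((hnet i).sub_const (y i)).pow 2).const_mul (1 / 2)).add
    ((HasFDerivAt.fun_sum fun r (_ : r ∈ Finset.univ) =>
      ((hpr r).sub_const (W₀ r)).norm_sq).const_mul (lam / 2))
  refine h1.congr_fderiv ?_
  ext H
  simp only [add_apply, sum_apply, smul_apply, ContinuousLinearMap.comp_apply,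
    innerSL_apply_apply, ContinuousLinearMap.proj_apply, lossGrad, inner_add_left, sum_inner,
    real_inner_smul_left, fderivInnerCLM_apply, ContinuousLinearMap.prod_apply,
    zero_apply, inner_zero_right, zero_add, smul_eq_mul, nsmul_eq_mul,
    Finset.sum_add_distrib, Finset.mul_sum]
  rw [Finset.sum_comm]
  congr 1
  · refine Finset.sum_congr rfl fun r _ => Finset.sum_congr rfl fun i _ => ?_
    rw [real_inner_comm (X i) (H r)]
    push_cast
    ring
  · refine Finset.sum_congr rfl fun r _ => ?_
    push_cast
    ring

/-- The law of the random initialization `(W(0), a)`: `w_r(0) ∼ N(0, κ² I_d)` and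
`a_r ∼ unif {-1, 1}`, all independent. -/
noncomputable def initLaw (m d : ℕ) (κ : ℝ) : Measure (Weights m d × (Fin m → ℝ)) :=
  (Measure.pi fun _ : Fin m =>
      multivariateGaussian (0 : EuclideanSpace ℝ (Fin d)) (κ ^ 2 • (1 : Matrix (Fin d) (Fin d) ℝ))).prod
    (Measure.pi fun _ : Fin m => uniformOn ({-1, 1} : Set ℝ))

/-- The neural tangent kernel
`K^∞(x, x') = E_{w ∼ N(0, I_d)} [x ⬝ x' 𝟙{w ⬝ x ≥ 0, w ⬝ x' ≥ 0}]`. -/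
noncomputable def ntk (x x' : EuclideanSpace ℝ (Fin d)) : ℝ :=
  ∫ w, Set.indicator {w : EuclideanSpace ℝ (Fin d) | 0 ≤ ⟪w, x⟫ ∧ 0 ≤ ⟪w, x'⟫}
    (fun _ => ⟪x, x'⟫) w ∂(stdGaussian (EuclideanSpace ℝ (Fin d)))

/-- The NTK matrix on the training data. -/
noncomputable def ntkMatrix (X : Fin n → EuclideanSpace ℝ (Fin d)) : Matrix (Fin n) (Fin n) ℝ :=
  Matrix.of fun i j => ntk (X i) (X j)

/-- The kernel ridge regression predictor `K_te^⊤ (K_tr + λ I)⁻¹ y` of the NTK. -/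
noncomputable def ntkPredictor (X : Fin n → EuclideanSpace ℝ (Fin d)) (y : Fin n → ℝ) (lam : ℝ)
    (x : EuclideanSpace ℝ (Fin d)) : ℝ :=
  (fun i => ntk x (X i)) ⬝ᵥ
    ((ntkMatrix X + lam • (1 : Matrix (Fin n) (Fin n) ℝ))⁻¹.mulVec y)

end WideNet

namespace WideNet

variable {n m d : ℕ}

/-! ### Absolutely continuous functions -/

lemma absolutelyContinuousOnInterval_comp_lipschitz {E F : Type*} [PseudoMetricSpace E]
    [PseudoMetricSpace F] {f : ℝ → E} {φ : E → F} {K : NNReal} {a b : ℝ} (hφ : LipschitzWith K φ)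
    (hf : AbsolutelyContinuousOnInterval f a b) :
    AbsolutelyContinuousOnInterval (fun t => φ (f t)) a b := by
  refine squeeze_zero (fun E => Finset.sum_nonneg fun i _ => dist_nonneg) (fun E => ?_)
    (by simpa using Tendsto.const_mul (K : ℝ) hf)
  rw [Finset.mul_sum]
  exact Finset.sum_le_sum fun i _ => hφ.dist_le_mul _ _

lemma absolutelyContinuousOnInterval_const {E : Type*} [PseudoMetricSpace E] (c : E) (a b : ℝ) :
    AbsolutelyContinuousOnInterval (fun _ : ℝ => c) a b :=
  ((LipschitzWith.const c).lipschitzOnWith (s := Set.uIcc a b)).absolutelyContinuousOnInterval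

lemma absolutelyContinuousOnInterval_sum {ι E : Type*} [NormedAddCommGroup E] {f : ι → ℝ → E}
    {a b : ℝ} (s : Finset ι) (hf : ∀ i ∈ s, AbsolutelyContinuousOnInterval (f i) a b) :
    AbsolutelyContinuousOnInterval (fun t => ∑ i ∈ s, f i t) a b := by
  classical
  induction s using Finset.induction_on with
  | empty => simpa using absolutelyContinuousOnInterval_const (0 : E) a b
  | insert i s hi ih =>
    simp only [Finset.sum_insert hi]
    exact (hf i (by simp)).add (ih fun j hj => hf j (by simp [hj]))

lemma le_of_absolutelyContinuous_of_deriv_nonpos {φ : ℝ → ℝ} {a b : ℝ} (hab : a ≤ b)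
    (hφ : AbsolutelyContinuousOnInterval φ a b)
    (hd : ∀ᵐ t, t ∈ Set.Ioo a b → ∃ p ≤ (0 : ℝ), HasDerivAt φ p t) : φ b ≤ φ a := by
  have h := hφ.integral_deriv_eq_sub
  have h2 : ∫ t in a..b, deriv φ t ≤ 0 := by
    rw [intervalIntegral.integral_of_le hab, ← integral_Ioc_eq_integral_Ioo.symm]
    refine integral_nonpos_of_ae ?_
    rw [EventuallyLE, ae_restrict_iff' measurableSet_Ioo]
    filter_upwards [hd] with t ht hmem
    obtain ⟨p, hp, hp'⟩ := ht hmem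
    simpa [hp'.deriv] using hp
  linarith

/-! ### The ReLU along a curve -/

lemma relu_lipschitz : LipschitzWith 1 relu := LipschitzWith.id.max_const 0

lemma mul_eq_relu {z g : ℝ} (hg : g ∈ reluSubdiff z) : g * z = relu z := by
  obtain ⟨h0, h1, hp, hn⟩ := hg
  rcases lt_trichotomy z 0 with h | h | h
  · simp [hn h, relu, h.le]
  · simp [h, relu]
  · simp [hp h, relu, h.le]

lemma HasDerivAt.eq_zero_of_zeros {z : ℝ → ℝ} {t p : ℝ} (hz : HasDerivAt z p t) (h0 : z t = 0)
    (hac : (𝓝[{s | z s = 0} ∩ Set.Ioi t] t).NeBot) : p = 0 := by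
  have h1 := hasDerivAt_iff_tendsto_slope.1 hz
  have hle : 𝓝[{s | z s = 0} ∩ Set.Ioi t] t ≤ 𝓝[≠] t :=
    nhdsWithin_mono _ fun s hs => ne_of_gt hs.2
  have h2 := h1.mono_left hle
  refine tendsto_nhds_unique h2 (tendsto_const_nhds.congr' ?_)
  filter_upwards [self_mem_nhdsWithin] with s hs
  have : z s = 0 := hs.1
  simp [slope, h0, this]

/-- The chain rule for the ReLU along a curve holds at almost every time, for every choice of the
subgradient. -/
lemma ae_hasDerivAt_relu (z : ℝ → ℝ) :
    ∀ᵐ t, ∀ p g : ℝ, HasDerivAt z p t → g ∈ reluSubdiff (z t) →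
      HasDerivAt (fun s => relu (z s)) (g * p) t := by
  have hc := countable_setOfPred_isolated_right_within (s := {s | z s = 0})
  filter_upwards [hc.ae_notMem volume] with t ht p g hp hg
  by_cases h0 : z t = 0
  · have hne : (𝓝[{s | z s = 0} ∩ Set.Ioi t] t).NeBot := by
      refine ⟨fun h => ht ⟨h0, h⟩⟩
    obtain rfl := HasDerivAt.eq_zero_of_zeros hp h0 hne
    rw [mul_zero, hasDerivAt_iff_isLittleO] at *
    refine Asymptotics.IsBigO.trans_isLittleO (.of_bound 1 (.of_forall fun s => ?_)) hp
    have := relu_lipschitz.dist_le_mul (z s) (z t)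
    simpa [Real.dist_eq] using this
  · exact (hasDerivAt_relu h0 hg).comp t hp

/-! ### The loss along a gradient flow -/

section loss

variable (X : Fin n → EuclideanSpace ℝ (Fin d)) (y : Fin n → ℝ) (lam : ℝ)
    (a : Fin m → ℝ) (W₀ : Weights m d)

/-- The linearized network with activation pattern `g`. -/
noncomputable def linNet (a g : Fin m → ℝ) (W : Weights m d) (x : EuclideanSpace ℝ (Fin d)) : ℝ :=
  (1 / Real.sqrt m) * ∑ r, a r * (g r * ⟪W r, x⟫)

lemma network_eq_linNet {a g : Fin m → ℝ} {W : Weights m d} {x : EuclideanSpace ℝ (Fin d)}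
    (hg : ∀ r, g r * ⟪W r, x⟫ = relu ⟪W r, x⟫) : network a W x = linNet a g W x := by
  simp [network, linNet, hg]

lemma sum_inner_lossGrad (W H : Weights m d) (g : Fin m → Fin n → ℝ) :
    ∑ r, ⟪lossGrad X y lam a W₀ W g r, H r⟫ =
      ∑ i, (network a W (X i) - y i) * linNet a (fun r => g r i) H (X i)
        + lam * ∑ r, ⟪W r - W₀ r, H r⟫ := by
  simp only [lossGrad, linNet, inner_add_left, sum_inner, real_inner_smul_left,
    Finset.sum_add_distrib, Finset.mul_sum]
  rw [Finset.sum_comm]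
  congr 1
  refine Finset.sum_congr rfl fun i _ => Finset.sum_congr rfl fun r _ => ?_
  rw [real_inner_comm (X i) (H r)]
  ring

lemma continuous_relu : Continuous relu := relu_lipschitz.continuous

lemma continuous_network (a : Fin m → ℝ) (x : EuclideanSpace ℝ (Fin d)) :
    Continuous fun W : Weights m d => network a W x := by
  unfold network
  refine continuous_const.mul (continuous_finsetSum _ fun r _ => continuous_const.mul ?_)
  exact continuous_relu.comp (by fun_prop)

lemma continuous_loss : Continuous (loss X y lam a W₀) := by
  unfold loss
  have := fun i => continuous_network (m := m) a (X i)
  fun_prop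

lemma absolutelyContinuous_network {W : ℝ → Weights m d} {s t : ℝ}
    (hW : AbsolutelyContinuousOnInterval W s t) (x : EuclideanSpace ℝ (Fin d)) :
    AbsolutelyContinuousOnInterval (fun τ => network a (W τ) x) s t := by
  unfold network
  refine AbsolutelyContinuousOnInterval.const_mul _
    (absolutelyContinuousOnInterval_sum _ fun r _ => AbsolutelyContinuousOnInterval.const_mul _ ?_)
  refine absolutelyContinuousOnInterval_comp_lipschitz relu_lipschitz ?_
  have h := absolutelyContinuousOnInterval_comp_lipschitz
    ((innerSL ℝ x).comp (ContinuousLinearMap.proj (R := ℝ)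
      (φ := fun _ : Fin m => EuclideanSpace ℝ (Fin d)) r)).lipschitz hW
  simpa [real_inner_comm] using h

lemma absolutelyContinuous_normSq_sub {W : ℝ → Weights m d} {s t : ℝ}
    (hW : AbsolutelyContinuousOnInterval W s t) (V : Weights m d) :
    AbsolutelyContinuousOnInterval (fun τ => ∑ r, ‖W τ r - V r‖ ^ 2) s t := by
  refine absolutelyContinuousOnInterval_sum _ fun r _ => ?_
  have h1 := absolutelyContinuousOnInterval_comp_lipschitz
    (ContinuousLinearMap.proj (R := ℝ)
      (φ := fun _ : Fin m => EuclideanSpace ℝ (Fin d)) r).lipschitz hW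
  have h2 := absolutelyContinuousOnInterval_comp_lipschitz lipschitzWith_one_norm
    (h1.fun_sub (absolutelyContinuousOnInterval_const (V r) s t))
  simpa [pow_two] using h2.fun_mul h2

lemma absolutelyContinuous_loss {W : ℝ → Weights m d} {s t : ℝ}
    (hW : AbsolutelyContinuousOnInterval W s t) :
    AbsolutelyContinuousOnInterval (fun τ => loss X y lam a W₀ (W τ)) s t := by
  unfold loss
  refine AbsolutelyContinuousOnInterval.fun_add (.const_mul _ ?_)
    (.const_mul _ (absolutelyContinuous_normSq_sub hW W₀))
  refine absolutelyContinuousOnInterval_sum _ fun i _ => ?_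
  have h := (absolutelyContinuous_network a hW (X i)).fun_sub
    (absolutelyContinuousOnInterval_const (y i) s t)
  simpa [pow_two] using h.fun_mul h

lemma hasDerivAt_normSq_sub {W : ℝ → Weights m d} {P : Weights m d} {t : ℝ}
    (hW : HasDerivAt W P t) (V : Weights m d) :
    HasDerivAt (fun τ => ∑ r, ‖W τ r - V r‖ ^ 2) (2 * ∑ r, ⟪W t r - V r, P r⟫) t := by
  rw [Finset.mul_sum]
  exact HasDerivAt.fun_sum fun r _ => ((hasDerivAt_pi.1 hW r).sub_const (V r)).norm_sq

variable {X y lam a W₀}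

lemma IsGradientFlow.mono_ac {W : ℝ → Weights m d} (hW : IsGradientFlow X y lam a W₀ W) {s t : ℝ}
    (hs : 0 ≤ s) (hst : s ≤ t) : AbsolutelyContinuousOnInterval W s t := by
  refine (hW.absCont (t + 1) (by linarith)).mono ?_
  rw [Set.uIcc_of_le hst, Set.uIcc_of_le (by linarith)]
  exact Set.Icc_subset_Icc hs (by linarith)

lemma IsGradientFlow.continuousOn {W : ℝ → Weights m d} (hW : IsGradientFlow X y lam a W₀ W) :
    ContinuousOn W (Set.Ici 0) := by
  intro t ht
  have h := (hW.mono_ac le_rfl (by linarith [Set.mem_Ici.1 ht] : (0 : ℝ) ≤ t + 1)).continuousOn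
  rw [Set.uIcc_of_le (by linarith [Set.mem_Ici.1 ht])] at h
  refine (h t ⟨ht, by linarith⟩).mono_of_mem_nhdsWithin ?_
  rw [← Set.Ici_inter_Iic]
  exact inter_mem_nhdsWithin _ (Iic_mem_nhds (by linarith))

lemma IsGradientFlow.flow' {W : ℝ → Weights m d} (hW : IsGradientFlow X y lam a W₀ W) :
    ∀ᵐ t, 0 < t → ∃ g : Fin m → Fin n → ℝ, (∀ r i, g r i ∈ reluSubdiff ⟪W t r, X i⟫) ∧
      HasDerivAt W (-lossGrad X y lam a W₀ (W t) g) t := by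
  have h := hW.flow
  rw [ae_restrict_iff' measurableSet_Ioi] at h
  filter_upwards [h] with t ht h0
  obtain ⟨G, ⟨g, hg, rfl⟩, hd⟩ := ht h0
  exact ⟨g, hg, hd⟩

/-- Energy dissipation along the flow. -/
lemma IsGradientFlow.ae_hasDerivAt_loss {W : ℝ → Weights m d}
    (hW : IsGradientFlow X y lam a W₀ W) :
    ∀ᵐ t, 0 < t → ∃ g : Fin m → Fin n → ℝ, (∀ r i, g r i ∈ reluSubdiff ⟪W t r, X i⟫) ∧
      HasDerivAt W (-lossGrad X y lam a W₀ (W t) g) t ∧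
      HasDerivAt (fun s => loss X y lam a W₀ (W s))
        (-∑ r, ‖lossGrad X y lam a W₀ (W t) g r‖ ^ 2) t := by
  have hr := ae_all_iff.2 fun r : Fin m => ae_all_iff.2 fun i : Fin n =>
    ae_hasDerivAt_relu fun s => ⟪W s r, X i⟫
  filter_upwards [hW.flow', hr] with t ht hr h0
  obtain ⟨g, hg, hd⟩ := ht h0
  refine ⟨g, hg, hd, ?_⟩
  set G := lossGrad X y lam a W₀ (W t) g with hG
  have hnet : ∀ i, HasDerivAt (fun s => network a (W s) (X i))
      (linNet a (fun r => g r i) (-G) (X i)) t := fun i => by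
    unfold network linNet
    refine (HasDerivAt.fun_sum fun r _ => HasDerivAt.const_mul (a r) ?_).const_mul _
    refine hr r i _ _ ?_ (hg r i)
    simpa using (hasDerivAt_pi.1 hd r).inner ℝ (hasDerivAt_const t (X i))
  have h1 := ((HasDerivAt.fun_sum fun i (_ : i ∈ Finset.univ) =>
    ((hnet i).sub_const (y i)).pow 2).const_mul (1 / 2)).add
      ((hasDerivAt_normSq_sub hd W₀).const_mul (lam / 2))
  refine h1.congr_deriv ?_
  have h2 := sum_inner_lossGrad X y lam a W₀ (W t) (-G) g
  rw [← hG] at h2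
  have h3 : ∑ r, ⟪G r, (-G) r⟫ = -∑ r, ‖G r‖ ^ 2 := by
    rw [← Finset.sum_neg_distrib]
    exact Finset.sum_congr rfl fun r _ => by simp
  rw [← h3, h2, Finset.mul_sum, Finset.mul_sum, Finset.mul_sum, Finset.mul_sum]
  congr 1
  · refine Finset.sum_congr rfl fun i _ => ?_
    push_cast
    ring
  · refine Finset.sum_congr rfl fun i _ => ?_
    ring

lemma IsGradientFlow.loss_antitone {W : ℝ → Weights m d} (hW : IsGradientFlow X y lam a W₀ W)
    {s t : ℝ} (hs : 0 ≤ s) (hst : s ≤ t) :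
    loss X y lam a W₀ (W t) ≤ loss X y lam a W₀ (W s) := by
  refine le_of_absolutelyContinuous_of_deriv_nonpos hst
    (absolutelyContinuous_loss X y lam a W₀ (hW.mono_ac hs hst)) ?_
  filter_upwards [hW.ae_hasDerivAt_loss] with τ hτ hm
  obtain ⟨g, -, -, h⟩ := hτ (hs.trans_lt hm.1)
  exact ⟨_, neg_nonpos.2 (Finset.sum_nonneg fun r _ => by positivity), h⟩

/-- A cell of activation patterns on which the loss is dominated by a strongly convex
quadratic. -/
lemma loss_add_inner_le {W V : Weights m d} (hlam : 0 ≤ lam) {g : Fin m → Fin n → ℝ}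
    (hg : ∀ r i, g r i ∈ reluSubdiff ⟪W r, X i⟫)
    (hV : ∀ r i, g r i * ⟪V r, X i⟫ = relu ⟪V r, X i⟫) :
    loss X y lam a W₀ W + ∑ r, ⟪lossGrad X y lam a W₀ W g r, V r - W r⟫ ≤
      loss X y lam a W₀ V := by
  rw [sum_inner_lossGrad X y lam a W₀ W (fun r => V r - W r) g]
  have hlin : ∀ i, linNet a (fun r => g r i) (fun r => V r - W r) (X i) =
      network a V (X i) - network a W (X i) := fun i => by
    rw [network_eq_linNet (fun r => hV r i),
      network_eq_linNet fun r => mul_eq_relu (hg r i), linNet, linNet, linNet, ← mul_sub,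
      ← Finset.sum_sub_distrib]
    simp [inner_sub_left, mul_sub]
  simp only [hlin, loss, Finset.mul_sum]
  have e1 : ∀ i, 1 / 2 * (network a W (X i) - y i) ^ 2 +
      (network a W (X i) - y i) * (network a V (X i) - network a W (X i)) ≤
      1 / 2 * (network a V (X i) - y i) ^ 2 := fun i => by
    nlinarith [sq_nonneg (network a V (X i) - network a W (X i))]
  have e2 : ∀ r, lam / 2 * ‖W r - W₀ r‖ ^ 2 + lam * ⟪W r - W₀ r, V r - W r⟫ ≤
      lam / 2 * ‖V r - W₀ r‖ ^ 2 := fun r => by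
    have h : ‖V r - W₀ r‖ ^ 2 =
        ‖W r - W₀ r‖ ^ 2 + 2 * ⟪W r - W₀ r, V r - W r⟫ + ‖V r - W r‖ ^ 2 := by
      rw [← norm_add_sq_real]
      congr 2
      abel
    rw [h]
    nlinarith [mul_nonneg hlam (sq_nonneg ‖V r - W r‖)]
  have s1 := Finset.sum_le_sum fun i (_ : i ∈ Finset.univ) => e1 i
  have s2 := Finset.sum_le_sum fun r (_ : r ∈ Finset.univ) => e2 r
  rw [Finset.sum_add_distrib] at s1 s2
  linarith

lemma eventually_mul_eq_relu (V : Weights m d) :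
    ∀ᶠ W in 𝓝 V, ∀ r i, ∀ g ∈ reluSubdiff ⟪W r, X i⟫, g * ⟪V r, X i⟫ = relu ⟪V r, X i⟫ := by
  rw [eventually_all]; intro r
  rw [eventually_all]; intro i
  have hc : Continuous fun W : Weights m d => ⟪W r, X i⟫ := by fun_prop
  rcases lt_trichotomy ⟪V r, X i⟫ 0 with h | h | h
  · filter_upwards [hc.continuousAt.eventually (Iio_mem_nhds h)] with W hW g hg
    simp [hg.2.2.2 hW, relu, h.le]
  · simp [h, relu]
  · filter_upwards [hc.continuousAt.eventually (Ioi_mem_nhds h)] with W hW g hg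
    simp [hg.2.2.1 hW, relu, h.le]

lemma norm_sub_lt_of_sum {V W : Weights m d} {ρ : ℝ} (hρ : 0 < ρ)
    (h : ∑ r, ‖W r - V r‖ ^ 2 < ρ ^ 2) : ‖W - V‖ < ρ := by
  rw [pi_norm_lt_iff hρ]
  intro r
  refine lt_of_pow_lt_pow_left₀ 2 hρ.le (lt_of_le_of_lt ?_ h)
  exact Finset.single_le_sum (f := fun r => ‖W r - V r‖ ^ 2) (fun _ _ => by positivity)
    (Finset.mem_univ r)

lemma loss_nonneg (hlam : 0 ≤ lam) (W : Weights m d) : 0 ≤ loss X y lam a W₀ W := by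
  unfold loss
  have : 0 ≤ ∑ i, (network a W (X i) - y i) ^ 2 := Finset.sum_nonneg fun _ _ => sq_nonneg _
  have : 0 ≤ ∑ r, ‖W r - W₀ r‖ ^ 2 := Finset.sum_nonneg fun _ _ => by positivity
  positivity

lemma IsGradientFlow.exists_clusterPt {W : ℝ → Weights m d} (hlam : 0 < lam)
    (hW : IsGradientFlow X y lam a W₀ W) : ∃ V, MapClusterPt V atTop W := by
  set ρ := Real.sqrt (2 / lam * loss X y lam a W₀ W₀) + 1 with hρ
  have hρ0 : 0 < ρ := by positivity
  have hb : ∀ t, 0 ≤ t → W t ∈ Metric.closedBall W₀ ρ := fun t ht => by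
    rw [mem_closedBall_iff_norm]
    refine (norm_sub_lt_of_sum hρ0 ?_).le
    have h1 := hW.loss_antitone le_rfl ht
    rw [hW.init] at h1
    have h2 : lam / 2 * ∑ r, ‖W t r - W₀ r‖ ^ 2 ≤ loss X y lam a W₀ (W t) := by
      rw [loss]
      have : 0 ≤ ∑ i, (network a (W t) (X i) - y i) ^ 2 := Finset.sum_nonneg fun _ _ => sq_nonneg _
      linarith
    have h3 : ∑ r, ‖W t r - W₀ r‖ ^ 2 ≤ 2 / lam * loss X y lam a W₀ W₀ := by
      rw [div_mul_eq_mul_div, le_div_iff₀ hlam]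
      linarith
    have h4 := loss_nonneg (X := X) (y := y) (a := a) (W₀ := W₀) hlam.le W₀
    have h5 := Real.sq_sqrt (by positivity : 0 ≤ 2 / lam * loss X y lam a W₀ W₀)
    have h6 := Real.sqrt_nonneg (2 / lam * loss X y lam a W₀ W₀)
    rw [hρ]
    nlinarith
  obtain ⟨V, -, hV⟩ := (isCompact_closedBall W₀ ρ).exists_mapClusterPt (f := atTop) (u := W)
    (le_principal_iff.2 (mem_map.2 (mem_of_superset (Ici_mem_atTop (0 : ℝ)) hb)))
  exact ⟨V, hV⟩

/-- Gradient flows of the regularized loss converge. -/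
theorem IsGradientFlow.exists_tendsto {W : ℝ → Weights m d} (hlam : 0 < lam)
    (hW : IsGradientFlow X y lam a W₀ W) : ∃ V, Tendsto W atTop (𝓝 V) := by
  obtain ⟨V, hV⟩ := hW.exists_clusterPt hlam
  refine ⟨V, ?_⟩
  have hlow : ∀ t, 0 ≤ t → loss X y lam a W₀ V ≤ loss X y lam a W₀ (W t) := fun t ht => by
    by_contra! hlt
    have h1 := hV.frequently
      ((continuous_loss X y lam a W₀).continuousAt.eventually (Ioi_mem_nhds hlt))
    obtain ⟨s, hs, hs'⟩ := (h1.and_eventually (eventually_ge_atTop t)).exists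
    exact absurd (hW.loss_antitone ht hs') (not_le.2 hs)
  obtain ⟨ρ, hρ, hball⟩ := Metric.eventually_nhds_iff.1 (eventually_mul_eq_relu (X := X) V)
  set v : ℝ → ℝ := fun t => ∑ r, ‖W t r - V r‖ ^ 2 with hv
  have hvc : ContinuousOn v (Set.Ici 0) := by
    have : Continuous fun U : Weights m d => ∑ r, ‖U r - V r‖ ^ 2 := by fun_prop
    exact this.comp_continuousOn hW.continuousOn
  have hfreq : ∀ η > 0, ∀ T, ∃ t ≥ T, v t < η := fun η hη T => by
    have hc : ContinuousAt (fun U : Weights m d => ∑ r, ‖U r - V r‖ ^ 2) V :=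
      Continuous.continuousAt (by fun_prop)
    have h0 : (fun U : Weights m d => ∑ r, ‖U r - V r‖ ^ 2) V < η := by simpa
    have h1 := hV.frequently (hc.eventually (Iio_mem_nhds h0))
    obtain ⟨s, hs, hs'⟩ := (h1.and_eventually (eventually_ge_atTop T)).exists
    exact ⟨s, hs', hs⟩
  have hstep : ∀ s t, 0 ≤ s → s ≤ t → (∀ τ ∈ Set.Ioo s t, v τ < ρ ^ 2) → v t ≤ v s := by
    intro s t hs hst hin
    refine le_of_absolutelyContinuous_of_deriv_nonpos hst
      (absolutelyContinuous_normSq_sub (hW.mono_ac hs hst) V) ?_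
    filter_upwards [hW.flow'] with τ hτ hm
    obtain ⟨g, hg, hd⟩ := hτ (hs.trans_lt hm.1)
    refine ⟨_, ?_, hasDerivAt_normSq_sub hd V⟩
    have h1 := hball (y := W τ) (by
      rw [dist_eq_norm]; exact norm_sub_lt_of_sum hρ (hin τ hm))
    have h2 := loss_add_inner_le (y := y) (a := a) (W₀ := W₀) hlam.le hg
      fun r i => h1 r i _ (hg r i)
    have h3 := hlow τ (hs.trans hm.1.le)
    have h4 : ∑ r, ⟪W τ r - V r, (-lossGrad X y lam a W₀ (W τ) g) r⟫ =
        ∑ r, ⟪lossGrad X y lam a W₀ (W τ) g r, V r - W τ r⟫ :=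
      Finset.sum_congr rfl fun r _ => by
        rw [real_inner_comm, Pi.neg_apply, inner_neg_left, ← inner_neg_right, neg_sub]
    rw [h4]
    linarith
  have htrap : ∀ s t, 0 ≤ s → s ≤ t → v s < ρ ^ 2 → v t ≤ v s := by
    intro s t hs hst hvs
    by_contra! hcon
    have hne : ({τ ∈ Set.Icc s t | ρ ^ 2 ≤ v τ}).Nonempty := by
      by_contra hem
      rw [Set.not_nonempty_iff_eq_empty, Set.eq_empty_iff_forall_notMem] at hem
      refine absurd (hstep s t hs hst fun τ hτ => ?_) (not_le.2 hcon)
      by_contra! h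
      exact hem τ ⟨Set.Ioo_subset_Icc_self hτ, h⟩
    have hcl : IsCompact {τ ∈ Set.Icc s t | ρ ^ 2 ≤ v τ} := by
      have h := (hvc.mono (fun τ hτ => hs.trans hτ.1 : Set.Icc s t ⊆ Set.Ici 0)).preimage_isClosed_of_isClosed
        isClosed_Icc (isClosed_Ici (a := ρ ^ 2))
      exact isCompact_Icc.of_isClosed_subset h Set.inter_subset_left
    obtain ⟨τ, ⟨hτ, hτv⟩, hmin⟩ := hcl.exists_isLeast hne
    have := hstep s τ hs hτ.1 fun σ hσ => by
      by_contra! h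
      exact absurd (hmin ⟨⟨hσ.1.le, hσ.2.le.trans hτ.2⟩, h⟩) (not_le.2 hσ.2)
    linarith
  rw [Metric.tendsto_atTop]
  intro η hη
  obtain ⟨s, hs, hvs⟩ := hfreq (min (ρ ^ 2) (η ^ 2)) (by positivity) 0
  refine ⟨s, fun t ht => ?_⟩
  rw [dist_eq_norm]
  refine norm_sub_lt_of_sum hη ?_
  have h1 := htrap s t hs ht (hvs.trans_le (min_le_left _ _))
  exact h1.trans_lt (hvs.trans_le (min_le_right _ _))

/-- Limits of gradient flows are stationary points which decrease the loss. -/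
theorem IsGradientFlow.stationary_of_tendsto {W : ℝ → Weights m d} (hlam : 0 < lam)
    (hW : IsGradientFlow X y lam a W₀ W) {V : Weights m d} (hV : Tendsto W atTop (𝓝 V)) :
    loss X y lam a W₀ V ≤ loss X y lam a W₀ W₀ ∧ 0 ∈ lossSubgrad X y lam a W₀ V := by
  constructor
  · refine le_of_tendsto (((continuous_loss X y lam a W₀).tendsto V).comp hV) ?_
    filter_upwards [eventually_ge_atTop (0 : ℝ)] with t ht
    have := hW.loss_antitone le_rfl ht
    rwa [hW.init] at this
  have hex : ∀ k : ℕ, ∃ t : ℝ, (k : ℝ) ≤ t ∧ ∃ g : Fin m → Fin n → ℝ,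
      (∀ r i, g r i ∈ reluSubdiff ⟪W t r, X i⟫) ∧
      ∑ r, ‖lossGrad X y lam a W₀ (W t) g r‖ ^ 2 < 1 / ((k : ℝ) + 1) := by
    intro k
    by_contra! hcon
    set c : ℝ := 1 / ((k : ℝ) + 1) with hc
    have hc0 : 0 < c := by positivity
    set L0 := loss X y lam a W₀ (W k) with hL0
    have hL0n : 0 ≤ L0 := loss_nonneg hlam.le _
    set T : ℝ := k + (L0 + 1) / c with hT
    have hkT : (k : ℝ) ≤ T := by rw [hT]; linarith [div_nonneg (by linarith : 0 ≤ L0 + 1) hc0.le]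
    have hac : AbsolutelyContinuousOnInterval (fun t => loss X y lam a W₀ (W t) + c * t) k T :=
      (absolutelyContinuous_loss X y lam a W₀ (hW.mono_ac (Nat.cast_nonneg k) hkT)).fun_add
        (.const_mul c (LipschitzWith.id.lipschitzOnWith.absolutelyContinuousOnInterval))
    have h := le_of_absolutelyContinuous_of_deriv_nonpos hkT hac (by
      filter_upwards [hW.ae_hasDerivAt_loss] with t ht hm
      obtain ⟨g, hg, -, hd⟩ := ht ((Nat.cast_nonneg k).trans_lt hm.1)
      refine ⟨_, ?_, hd.add ((hasDerivAt_id t).const_mul c)⟩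
      have := hcon t hm.1.le g hg
      linarith)
    have h2 := loss_nonneg (X := X) (y := y) (a := a) (W₀ := W₀) hlam.le (W T)
    have h3 : c * T = c * k + (L0 + 1) := by rw [hT]; field_simp
    linarith
  choose t ht g hg hG using hex
  have htop : Tendsto t atTop atTop := tendsto_atTop_mono ht tendsto_natCast_atTop_atTop
  have hmem : ∀ k, g k ∈ Set.Icc (0 : Fin m → Fin n → ℝ) 1 := fun k =>
    ⟨fun r i => (hg k r i).1, fun r i => (hg k r i).2.1⟩
  obtain ⟨γ, hγ, φ, hφ, hlim⟩ := isCompact_Icc.tendsto_subseq hmem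
  have hWφ : Tendsto (fun k => W (t (φ k))) atTop (𝓝 V) :=
    hV.comp (htop.comp hφ.tendsto_atTop)
  have hγlim : ∀ r i, Tendsto (fun k => g (φ k) r i) atTop (𝓝 (γ r i)) := fun r i =>
    tendsto_pi_nhds.1 (tendsto_pi_nhds.1 hlim r) i
  refine ⟨γ, fun r i => ⟨hγ.1 r i, hγ.2 r i, fun hpos => ?_, fun hneg => ?_⟩, ?_⟩
  · have hc : Continuous fun U : Weights m d => ⟪U r, X i⟫ := by fun_prop
    refine tendsto_nhds_unique (hγlim r i) (tendsto_const_nhds.congr' ?_)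
    filter_upwards [((hc.tendsto V).comp hWφ).eventually (Ioi_mem_nhds hpos)] with k hk
    exact ((hg (φ k) r i).2.2.1 hk).symm
  · have hc : Continuous fun U : Weights m d => ⟪U r, X i⟫ := by fun_prop
    refine tendsto_nhds_unique (hγlim r i) (tendsto_const_nhds.congr' ?_)
    filter_upwards [((hc.tendsto V).comp hWφ).eventually (Iio_mem_nhds hneg)] with k hk
    exact ((hg (φ k) r i).2.2.2 hk).symm
  · have hc : Continuous fun p : Weights m d × (Fin m → Fin n → ℝ) =>
        ∑ r, ‖lossGrad X y lam a W₀ p.1 p.2 r‖ ^ 2 := by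
      unfold lossGrad
      have := fun i => continuous_network (m := m) a (X i)
      fun_prop
    have h1 := (hc.tendsto (V, γ)).comp (hWφ.prodMk_nhds hlim)
    have h2 : Tendsto (fun k : ℕ => 1 / (((φ k : ℕ) : ℝ) + 1)) atTop (𝓝 0) :=
      tendsto_one_div_add_atTop_nhds_zero_nat.comp hφ.tendsto_atTop
    have h3 : ∑ r, ‖lossGrad X y lam a W₀ V γ r‖ ^ 2 ≤ 0 :=
      le_of_tendsto_of_tendsto' h1 h2 fun k => (hG (φ k)).le
    have h4 := (Finset.sum_eq_zero_iff_of_nonneg fun r _ => by positivity).1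
      (le_antisymm h3 (Finset.sum_nonneg fun r _ => by positivity))
    funext r
    symm
    simpa using (pow_eq_zero_iff two_ne_zero).1 (h4 r (Finset.mem_univ r))

end loss

/-! ### Existence of solutions for vector fields with jumps -/

section existence

variable {ι E : Type*} [Fintype ι] [NormedAddCommGroup E] [NormedSpace ℝ E]

/-- The quantitative step of the Euler scheme: if `w` follows the field `b + ∑ γᵢ cᵢ` with steps of
size `τ`, its increments are those of the field frozen at `w p`, up to a quadratic error. -/
lemma euler_increment_le {b : E → E} {c : ι → E → E} {K : NNReal} (hb : LipschitzWith K b)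
    (hc : ∀ i, LipschitzWith K (c i)) {w : ℕ → E} {γ : ℕ → ι → ℝ} {τ M : ℝ} (hτ : 0 ≤ τ)
    (hγ0 : ∀ l i, 0 ≤ γ l i) (hγ1 : ∀ l i, γ l i ≤ 1)
    (hw : ∀ l, w (l + 1) = w l + τ • (b (w l) + ∑ i, γ l i • c i (w l)))
    {j k p : ℕ} (hjp : j ≤ p) (hpk : p ≤ k)
    (hstep : ∀ l < k, ‖w (l + 1) - w l‖ ≤ τ * M) :
    ‖w k - w j - (((k : ℝ) - j) * τ) • b (w p) -
        ∑ i, (∑ l ∈ Finset.range k, τ * γ l i - ∑ l ∈ Finset.range j, τ * γ l i) • c i (w p)‖ ≤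
      (1 + Fintype.card ι) * K * M * (((k : ℝ) - j) * τ) ^ 2 := by
  have hjk := hjp.trans hpk
  have hM : j < k → 0 ≤ τ * M := fun h => (norm_nonneg _).trans (hstep j h)
  have hdist : ∀ l ∈ Finset.Ico j k, ‖w l - w p‖ ≤ ((k : ℝ) - j) * (τ * M) := by
    intro l hl
    rw [Finset.mem_Ico] at hl
    have key : ∀ u v : ℕ, j ≤ u → u ≤ v → v ≤ k → ‖w u - w v‖ ≤ ((k : ℝ) - j) * (τ * M) := by
      intro u v hju huv hvk
      have h := dist_le_Ico_sum_of_dist_le (f := w) (d := fun _ => τ * M) huv (by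
        intro q _ hq
        rw [dist_comm, dist_eq_norm]
        exact hstep q (hq.trans_le hvk))
      rw [← dist_eq_norm]
      refine h.trans ?_
      rw [Finset.sum_const, Nat.card_Ico, nsmul_eq_mul, Nat.cast_sub huv]
      refine mul_le_mul_of_nonneg_right ?_ (hM (hl.1.trans_lt hl.2))
      have : (v : ℝ) ≤ k := by exact_mod_cast hvk
      have : (j : ℝ) ≤ u := by exact_mod_cast hju
      linarith
    rcases le_total l p with h | h
    · exact key l p hl.1 h hpk
    · rw [norm_sub_rev]
      exact key p l hjp h hl.2.le
  have e1 : w k - w j = ∑ l ∈ Finset.Ico j k, τ • (b (w l) + ∑ i, γ l i • c i (w l)) := by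
    rw [← Finset.sum_Ico_sub w hjk]
    exact Finset.sum_congr rfl fun l _ => by rw [hw l, add_sub_cancel_left]
  have e2 : (((k : ℝ) - j) * τ) • b (w p) = ∑ l ∈ Finset.Ico j k, τ • b (w p) := by
    rw [Finset.sum_const, Nat.card_Ico, ← Nat.cast_smul_eq_nsmul ℝ, smul_smul, Nat.cast_sub hjk]
  have e3 : ∑ i, (∑ l ∈ Finset.range k, τ * γ l i - ∑ l ∈ Finset.range j, τ * γ l i) • c i (w p) =
      ∑ l ∈ Finset.Ico j k, τ • ∑ i, γ l i • c i (w p) := by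
    simp_rw [← Finset.sum_Ico_eq_sub _ hjk, Finset.sum_smul, Finset.smul_sum, smul_smul]
    rw [Finset.sum_comm]
  rw [e1, e2, e3, ← Finset.sum_sub_distrib, ← Finset.sum_sub_distrib]
  have hterm : ∀ l ∈ Finset.Ico j k,
      ‖τ • (b (w l) + ∑ i, γ l i • c i (w l)) - τ • b (w p) - τ • ∑ i, γ l i • c i (w p)‖ ≤
        τ * ((1 + Fintype.card ι) * (K * (((k : ℝ) - j) * (τ * M)))) := by
    intro l hl
    have hd := hdist l hl
    have e : τ • (b (w l) + ∑ i, γ l i • c i (w l)) - τ • b (w p) - τ • ∑ i, γ l i • c i (w p) =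
        τ • ((b (w l) - b (w p)) + ∑ i, γ l i • (c i (w l) - c i (w p))) := by
      simp only [smul_sub, Finset.sum_sub_distrib, smul_add]
      abel
    rw [e, norm_smul, Real.norm_of_nonneg hτ]
    refine mul_le_mul_of_nonneg_left ?_ hτ
    have hlip : ∀ f : E → E, LipschitzWith K f →
        ‖f (w l) - f (w p)‖ ≤ K * (((k : ℝ) - j) * (τ * M)) := fun f hf => by
      have := hf.dist_le_mul (w l) (w p)
      rw [dist_eq_norm, dist_eq_norm] at this
      exact this.trans (mul_le_mul_of_nonneg_left hd K.2)
    have hsum : ‖∑ i, γ l i • (c i (w l) - c i (w p))‖ ≤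
        Fintype.card ι * (K * (((k : ℝ) - j) * (τ * M))) := by
      refine (norm_sum_le _ _).trans ?_
      refine (Finset.sum_le_sum fun i _ => (?_ : _ ≤ K * (((k : ℝ) - j) * (τ * M)))).trans ?_
      · rw [norm_smul, Real.norm_of_nonneg (hγ0 l i)]
        exact (mul_le_of_le_one_left (norm_nonneg _) (hγ1 l i)).trans (hlip _ (hc i))
      · simp
    have := norm_add_le (b (w l) - b (w p)) (∑ i, γ l i • (c i (w l) - c i (w p)))
    have := hlip b hb
    linarith
  refine (norm_sum_le_of_le _ hterm).trans (le_of_eq ?_)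
  rw [Finset.sum_const, Nat.card_Ico, nsmul_eq_mul, Nat.cast_sub hjk]
  ring

/-- The field `b + ∑ 𝟙{zᵢ ≥ 0} cᵢ`. -/
noncomputable def jumpField (b : E → E) (c : ι → E → E) (z : ι → E →L[ℝ] ℝ) (x : E) : E :=
  b x + ∑ i, (if 0 ≤ z i x then (1 : ℝ) else 0) • c i x

lemma exists_jumpField_growth {b : E → E} {c : ι → E → E} {K : NNReal} (hb : LipschitzWith K b)
    (hc : ∀ i, LipschitzWith K (c i)) (z : ι → E →L[ℝ] ℝ) (x₀ : E) :
    ∃ B : ℝ, 0 ≤ B ∧ ∀ x, ‖jumpField b c z x‖ ≤ B * (1 + ‖x - x₀‖) := by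
  have hlip : ∀ f : E → E, LipschitzWith K f → ∀ x, ‖f x‖ ≤ ‖f x₀‖ + K * ‖x - x₀‖ := by
    intro f hf x
    have := hf.dist_le_mul x x₀
    rw [dist_eq_norm, dist_eq_norm] at this
    have h2 := norm_add_le (f x₀) (f x - f x₀)
    rw [add_sub_cancel] at h2
    linarith
  refine ⟨(‖b x₀‖ + K) + ∑ i, (‖c i x₀‖ + K), by positivity, fun x => ?_⟩
  rw [jumpField, add_mul]
  have h1 : ∀ f : E → E, LipschitzWith K f → ‖f x‖ ≤ (‖f x₀‖ + K) * (1 + ‖x - x₀‖) := by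
    intro f hf
    have := hlip f hf x
    have h3 : 0 ≤ ‖f x₀‖ * ‖x - x₀‖ := by positivity
    have h4 : (0 : ℝ) ≤ K := K.2
    nlinarith
  refine (norm_add_le _ _).trans (add_le_add (h1 b hb) ?_)
  rw [Finset.sum_mul]
  refine norm_sum_le_of_le _ fun i _ => ?_
  refine le_trans ?_ (h1 _ (hc i))
  split_ifs <;> simp

/-- The Euler scheme for a field with jumps. -/
noncomputable def eulerSeq (b : E → E) (c : ι → E → E) (z : ι → E →L[ℝ] ℝ) (x₀ : E) (τ : ℝ)
    (l : ℕ) : E :=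
  (fun x => x + τ • jumpField b c z x)^[l] x₀

lemma eulerSeq_succ (b : E → E) (c : ι → E → E) (z : ι → E →L[ℝ] ℝ) (x₀ : E) (τ : ℝ) (l : ℕ) :
    eulerSeq b c z x₀ τ (l + 1) =
      eulerSeq b c z x₀ τ l + τ • jumpField b c z (eulerSeq b c z x₀ τ l) := by
  rw [eulerSeq, Function.iterate_succ_apply']
  rfl

lemma eulerSeq_bound {b : E → E} {c : ι → E → E} {z : ι → E →L[ℝ] ℝ} {x₀ : E} {B τ : ℝ}
    (hB : 0 ≤ B) (hτ : 0 ≤ τ) (h : ∀ x, ‖jumpField b c z x‖ ≤ B * (1 + ‖x - x₀‖)) (l : ℕ) :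
    1 + ‖eulerSeq b c z x₀ τ l - x₀‖ ≤ Real.exp (B * (l * τ)) := by
  induction l with
  | zero => simp [eulerSeq]
  | succ l ih =>
    rw [eulerSeq_succ]
    set w := eulerSeq b c z x₀ τ l
    have h1 : ‖w + τ • jumpField b c z w - x₀‖ ≤ ‖w - x₀‖ + τ * ‖jumpField b c z w‖ := by
      rw [add_sub_right_comm]
      refine (norm_add_le _ _).trans ?_
      rw [norm_smul, Real.norm_of_nonneg hτ]
    have h2 := mul_le_mul_of_nonneg_left (h w) hτ
    have h3 : 1 + B * τ ≤ Real.exp (B * τ) := by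
      linarith [Real.add_one_le_exp (B * τ)]
    calc 1 + ‖w + τ • jumpField b c z w - x₀‖ ≤ (1 + ‖w - x₀‖) * (1 + B * τ) := by nlinarith
      _ ≤ Real.exp (B * (l * τ)) * Real.exp (B * τ) := by gcongr
      _ = Real.exp (B * ((l + 1 : ℕ) * τ)) := by
        rw [← Real.exp_add]
        push_cast
        ring_nf

lemma exists_tendsto_hyperfilter_of_bounded {F : Type*} [NormedAddCommGroup F] [ProperSpace F]
    {u : ℕ → F} {C : ℝ} (hu : ∀ k, ‖u k‖ ≤ C) :
    ∃ x, Tendsto u (hyperfilter ℕ) (𝓝 x) := by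
  obtain ⟨x, -, hx⟩ := (isCompact_closedBall (0 : F) C).ultrafilter_le_nhds
    ((hyperfilter ℕ).map u) (le_principal_iff.2 (Filter.mem_map.2 (Filter.univ_mem' fun k => by
      simpa using hu k)))
  exact ⟨x, hx⟩

/-- A limit of the Euler scheme, along with the limits `Γ` of the integrated jump indicators. -/
lemma exists_euler_limit [ProperSpace E] {b : E → E} {c : ι → E → E} {K : NNReal}
    (hb : LipschitzWith K b) (hc : ∀ i, LipschitzWith K (c i)) (z : ι → E →L[ℝ] ℝ) (x₀ : E) :
    ∃ (W : ℝ → E) (Γ : ι → ℝ → ℝ), W 0 = x₀ ∧ ∀ T : ℝ, ∃ M C : ℝ, 0 ≤ M ∧ 0 ≤ C ∧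
      ∀ s t : ℝ, 0 ≤ s → s ≤ t → t ≤ T →
        ‖W t - W s‖ ≤ M * (t - s) ∧
        (∀ i, 0 ≤ Γ i t - Γ i s ∧ Γ i t - Γ i s ≤ t - s) ∧
        (∀ i, ‖z i‖ * M * (t - s) < z i (W s) → Γ i t - Γ i s = t - s) ∧
        (∀ i, z i (W s) < -(‖z i‖ * M * (t - s)) → Γ i t - Γ i s = 0) ∧
        ‖W t - W s - (t - s) • b (W s) - ∑ i, (Γ i t - Γ i s) • c i (W s)‖ ≤ C * (t - s) ^ 2 ∧
        ‖W t - W s - (t - s) • b (W t) - ∑ i, (Γ i t - Γ i s) • c i (W t)‖ ≤ C * (t - s) ^ 2 := by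
  obtain ⟨B, hB, hgrow⟩ := exists_jumpField_growth hb hc z x₀
  set τ : ℕ → ℝ := fun N => 1 / ((N : ℝ) + 1) with hτdef
  have hτ : ∀ N, 0 < τ N := fun N => by positivity
  set w : ℕ → ℕ → E := fun N => eulerSeq b c z x₀ (τ N) with hw
  set γ : ℕ → ℕ → ι → ℝ := fun N l i => if 0 ≤ z i (w N l) then 1 else 0 with hγ
  have hγ0 : ∀ N l i, 0 ≤ γ N l i := fun N l i => by simp only [hγ]; split_ifs <;> simp
  have hγ1 : ∀ N l i, γ N l i ≤ 1 := fun N l i => by simp only [hγ]; split_ifs <;> simp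
  have hsucc : ∀ N l, w N (l + 1) = w N l + τ N • (b (w N l) + ∑ i, γ N l i • c i (w N l)) :=
    fun N l => eulerSeq_succ b c z x₀ (τ N) l
  set k : ℕ → ℝ → ℕ := fun N t => ⌊t * ((N : ℝ) + 1)⌋₊ with hk
  set Γ' : ℕ → ι → ℝ → ℝ := fun N i t => ∑ l ∈ Finset.range (k N t), τ N * γ N l i with hΓ'
  have hkmono : ∀ N s t, s ≤ t → k N s ≤ k N t := fun N s t h =>
    Nat.floor_mono (mul_le_mul_of_nonneg_right h (by positivity))
  have hkle : ∀ N t, 0 ≤ t → k N t * τ N ≤ t := fun N t ht => by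
    rw [hτdef, mul_one_div, div_le_iff₀ (by positivity)]
    exact Nat.floor_le (by positivity)
  have hklim : ∀ t, 0 ≤ t → Tendsto (fun N => k N t * τ N) (hyperfilter ℕ) (𝓝 t) := fun t ht => by
    have h := (tendsto_nat_floor_mul_div_atTop ht).comp
      (tendsto_atTop_add_const_right atTop (1 : ℝ) tendsto_natCast_atTop_atTop)
    refine Tendsto.mono_left (Tendsto.congr (fun N => ?_) h) (Nat.hyperfilter_le_atTop)
    simp only [hk, hτdef, Function.comp, mul_one_div]
  have hbd : ∀ (N l : ℕ) (T : ℝ), l * τ N ≤ T → 1 + ‖w N l - x₀‖ ≤ Real.exp (B * T) := fun N l T hl =>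
    (eulerSeq_bound hB (hτ N).le hgrow l).trans
      (Real.exp_le_exp.2 (mul_le_mul_of_nonneg_left hl hB))
  have hWex : ∀ t : ℝ, ∃ x, Tendsto (fun N => w N (k N t)) (hyperfilter ℕ) (𝓝 x) := fun t => by
    refine exists_tendsto_hyperfilter_of_bounded (C := ‖x₀‖ + Real.exp (B * max t 0)) fun N => ?_
    have h1 : k N t * τ N ≤ max t 0 :=
      (mul_le_mul_of_nonneg_right (Nat.cast_le.2 (hkmono N t _ (le_max_left t 0))) (hτ N).le).trans
        (hkle N _ (le_max_right _ _))
    have h2 := hbd N _ _ h1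
    have h3 := norm_add_le x₀ (w N (k N t) - x₀)
    rw [add_sub_cancel] at h3
    linarith
  have hΓex : ∀ i, ∀ t : ℝ, ∃ x, Tendsto (fun N => Γ' N i t) (hyperfilter ℕ) (𝓝 x) := fun i t => by
    refine exists_tendsto_hyperfilter_of_bounded (C := max t 0) fun N => ?_
    have h1 : k N t * τ N ≤ max t 0 :=
      (mul_le_mul_of_nonneg_right (Nat.cast_le.2 (hkmono N t _ (le_max_left t 0))) (hτ N).le).trans
        (hkle N _ (le_max_right _ _))
    rw [Real.norm_of_nonneg (Finset.sum_nonneg fun l _ => mul_nonneg (hτ N).le (hγ0 N l i))]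
    refine (Finset.sum_le_sum fun l _ =>
      mul_le_of_le_one_right (hτ N).le (hγ1 N l i)).trans ?_
    simpa using h1
  choose W hW using hWex
  choose Γ hΓ using hΓex
  refine ⟨W, Γ, ?_, fun T => ?_⟩
  · refine tendsto_nhds_unique (hW 0) (tendsto_const_nhds.congr fun N => ?_)
    simp [hk, hw, eulerSeq]
  set M := B * Real.exp (B * T) with hM
  have hM0 : 0 ≤ M := by positivity
  refine ⟨M, (1 + Fintype.card ι) * K * M, hM0, by positivity, fun s t hs hst htT => ?_⟩
  have ht := hs.trans hst
  have hstep : ∀ N, ∀ l < k N t, ‖w N (l + 1) - w N l‖ ≤ τ N * M := fun N l hl => by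
    rw [hsucc, add_sub_cancel_left, norm_smul, Real.norm_of_nonneg (hτ N).le]
    refine mul_le_mul_of_nonneg_left ((hgrow (w N l)).trans ?_) (hτ N).le
    refine mul_le_mul_of_nonneg_left (hbd N l T ?_) hB
    exact (mul_le_mul_of_nonneg_right (Nat.cast_le.2 hl.le) (hτ N).le).trans
      ((hkle N t ht).trans htT)
  have hkk := fun N => hkmono N s t hst
  have hdiff : Tendsto (fun N => ((k N t : ℝ) - k N s) * τ N) (hyperfilter ℕ) (𝓝 (t - s)) := by
    simpa only [sub_mul] using (hklim t ht).sub (hklim s hs)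
  have hΔ : ∀ N i, Γ' N i t - Γ' N i s = ∑ l ∈ Finset.Ico (k N s) (k N t), τ N * γ N l i :=
    fun N i => (Finset.sum_Ico_eq_sub _ (hkk N)).symm
  have hcard : ∀ N, ∑ l ∈ Finset.Ico (k N s) (k N t), τ N = ((k N t : ℝ) - k N s) * τ N :=
    fun N => by rw [Finset.sum_const, Nat.card_Ico, nsmul_eq_mul, Nat.cast_sub (hkk N)]
  have hmove : ∀ N l, k N s ≤ l → l ≤ k N t →
      ‖w N l - w N (k N s)‖ ≤ M * (((k N t : ℝ) - k N s) * τ N) := fun N l h1 h2 => by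
    have h := dist_le_Ico_sum_of_dist_le (f := w N) (d := fun _ => τ N * M) h1 (by
      intro q _ hq
      rw [dist_comm, dist_eq_norm]
      exact hstep N q (hq.trans_le h2))
    rw [norm_sub_rev, ← dist_eq_norm]
    refine h.trans ?_
    rw [Finset.sum_const, Nat.card_Ico, nsmul_eq_mul, Nat.cast_sub h1]
    have : (l : ℝ) ≤ k N t := by exact_mod_cast h2
    have := mul_nonneg (hτ N).le hM0
    nlinarith
  have hzmove : ∀ N l i, k N s ≤ l → l ≤ k N t →
      |z i (w N l) - z i (w N (k N s))| ≤ ‖z i‖ * (M * (((k N t : ℝ) - k N s) * τ N)) :=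
    fun N l i h1 h2 => by
      rw [← map_sub, ← Real.norm_eq_abs]
      exact ((z i).le_opNorm _).trans
        (mul_le_mul_of_nonneg_left (hmove N l h1 h2) (norm_nonneg _))
  have hzlim : ∀ i, Tendsto (fun N => ‖z i‖ * (M * (((k N t : ℝ) - k N s) * τ N)))
      (hyperfilter ℕ) (𝓝 (‖z i‖ * (M * (t - s)))) := fun i =>
    (hdiff.const_mul M).const_mul _
  have hzW : ∀ i, Tendsto (fun N => z i (w N (k N s))) (hyperfilter ℕ) (𝓝 (z i (W s))) :=
    fun i => ((z i).continuous.tendsto _).comp (hW s)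
  refine ⟨?_, fun i => ⟨?_, ?_⟩, fun i hi => ?_, fun i hi => ?_, ?_, ?_⟩
  · refine le_of_tendsto_of_tendsto' ((hW t).sub (hW s)).norm (hdiff.const_mul M) fun N => ?_
    exact hmove N _ (hkk N) le_rfl
  · refine ge_of_tendsto' ((hΓ i t).sub (hΓ i s)) fun N => ?_
    rw [hΔ]
    exact Finset.sum_nonneg fun l _ => mul_nonneg (hτ N).le (hγ0 N l i)
  · refine le_of_tendsto_of_tendsto' ((hΓ i t).sub (hΓ i s)) hdiff fun N => ?_
    rw [hΔ, ← hcard]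
    exact Finset.sum_le_sum fun l _ => mul_le_of_le_one_right (hτ N).le (hγ1 N l i)
  · refine tendsto_nhds_unique ((hΓ i t).sub (hΓ i s)) (hdiff.congr' ?_)
    rw [mul_assoc] at hi
    filter_upwards [(hzlim i).eventually_lt (hzW i) hi] with N hN
    rw [hΔ, ← hcard]
    refine Finset.sum_congr rfl fun l hl => ?_
    rw [Finset.mem_Ico] at hl
    have := (abs_le.1 (hzmove N l i hl.1 hl.2.le)).1
    simp only [hγ]
    rw [if_pos (by linarith), mul_one]
  · refine tendsto_nhds_unique ((hΓ i t).sub (hΓ i s)) (tendsto_const_nhds.congr' ?_)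
    rw [mul_assoc] at hi
    filter_upwards [(hzW i).eventually_lt (hzlim i).neg hi] with N hN
    rw [hΔ]
    symm
    refine Finset.sum_eq_zero fun l hl => ?_
    rw [Finset.mem_Ico] at hl
    have := (abs_le.1 (hzmove N l i hl.1 hl.2.le)).2
    simp only [hγ]
    rw [if_neg (by linarith), mul_zero]
  · refine le_of_tendsto_of_tendsto' (Tendsto.norm ((((hW t).sub (hW s)).sub
      (hdiff.smul ((hb.continuous.tendsto _).comp (hW s)))).sub (tendsto_finsetSum _ fun i _ =>
        ((hΓ i t).sub (hΓ i s)).smul (((hc i).continuous.tendsto _).comp (hW s)))))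
      ((hdiff.pow 2).const_mul _) fun N => ?_
    exact euler_increment_le hb hc (hτ N).le (hγ0 N) (hγ1 N) (hsucc N) le_rfl (hkk N) (hstep N)
  · refine le_of_tendsto_of_tendsto' (Tendsto.norm ((((hW t).sub (hW s)).sub
      (hdiff.smul ((hb.continuous.tendsto _).comp (hW t)))).sub (tendsto_finsetSum _ fun i _ =>
        ((hΓ i t).sub (hΓ i s)).smul (((hc i).continuous.tendsto _).comp (hW t)))))
      ((hdiff.pow 2).const_mul _) fun N => ?_
    exact euler_increment_le hb hc (hτ N).le (hγ0 N) (hγ1 N) (hsucc N) (hkk N) le_rfl (hstep N)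

/-- Global existence for the differential inclusion `W' ∈ b(W) + ∑ᵢ ∂σ(zᵢ(W)) cᵢ(W)`. -/
theorem exists_solution_of_jumps [ProperSpace E] {b : E → E} {c : ι → E → E} {K : NNReal}
    (hb : LipschitzWith K b) (hc : ∀ i, LipschitzWith K (c i)) (z : ι → E →L[ℝ] ℝ) (x₀ : E) :
    ∃ W : ℝ → E, W 0 = x₀ ∧ (∀ T : ℝ, 0 < T → AbsolutelyContinuousOnInterval W 0 T) ∧
      ∀ᵐ t, 0 < t → ∃ γ : ι → ℝ, (∀ i, γ i ∈ reluSubdiff (z i (W t))) ∧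
        HasDerivAt W (b (W t) + ∑ i, γ i • c i (W t)) t := by
  obtain ⟨W, Γ, hW0, hT⟩ := exists_euler_limit hb hc z x₀
  refine ⟨W, hW0, fun T hTpos => ?_, ?_⟩
  · obtain ⟨M, C, hM, -, h⟩ := hT T
    refine LipschitzOnWith.absolutelyContinuousOnInterval (K := ⟨M, hM⟩) ?_
    rw [Set.uIcc_of_le hTpos.le]
    refine LipschitzOnWith.of_dist_le_mul fun s hs t ht => ?_
    rw [dist_eq_norm, Real.dist_eq]
    rcases le_total s t with hst | hst
    · have := (h s t hs.1 hst ht.2).1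
      rw [norm_sub_rev, abs_sub_comm, abs_of_nonneg (by linarith)]
      exact this
    · have := (h t s ht.1 hst hs.2).1
      rw [abs_of_nonneg (by linarith)]
      exact this
  have hmono : ∀ i, MonotoneOn (Γ i) (Set.Ici 0) := fun i s hs t _ hst => by
    obtain ⟨M, C, -, -, h⟩ := hT t
    linarith [((h s t hs hst le_rfl).2.1 i).1]
  have hdiff := ae_all_iff.2 fun i => (hmono i).ae_differentiableWithinAt_of_mem
  filter_upwards [hdiff] with t hdt ht
  have hd : ∀ i, HasDerivAt (Γ i) (deriv (Γ i) t) t := fun i =>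
    ((hdt i ht.le).differentiableAt (Ici_mem_nhds ht)).hasDerivAt
  obtain ⟨M, C, hM, hC, h⟩ := hT (t + 1)
  have hright : ∀ i (q : ℝ), (∀ᶠ s in 𝓝[>] t, Γ i s - Γ i t = q * (s - t)) → deriv (Γ i) t = q := by
    intro i q hq
    have h1 := (hasDerivAt_iff_tendsto_slope.1 (hd i)).mono_left
      (nhdsWithin_mono t fun s hs => ne_of_gt hs : 𝓝[>] t ≤ 𝓝[≠] t)
    refine tendsto_nhds_unique h1 (tendsto_const_nhds.congr' ?_)
    filter_upwards [hq, self_mem_nhdsWithin] with s hs hs'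
    have : s - t ≠ 0 := (sub_pos.2 hs').ne'
    rw [slope_def_field, hs]
    field_simp
  have hnear : ∀ᶠ s in 𝓝[>] t, s ≤ t + 1 :=
    mem_nhdsWithin_of_mem_nhds (Iic_mem_nhds (by linarith))
  have hsmall : ∀ i, Tendsto (fun s => ‖z i‖ * M * (s - t)) (𝓝[>] t) (𝓝 0) := fun i => by
    have : Continuous fun s : ℝ => ‖z i‖ * M * (s - t) := by fun_prop
    simpa using (this.tendsto t).mono_left nhdsWithin_le_nhds
  refine ⟨fun i => deriv (Γ i) t, fun i => ⟨?_, ?_, fun hpos => ?_, fun hneg => ?_⟩, ?_⟩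
  · have h1 := (hasDerivAt_iff_tendsto_slope.1 (hd i)).mono_left
      (nhdsWithin_mono t fun s hs => ne_of_gt hs : 𝓝[>] t ≤ 𝓝[≠] t)
    refine ge_of_tendsto h1 ?_
    filter_upwards [hnear, self_mem_nhdsWithin] with s hs hs'
    rw [slope_def_field]
    exact div_nonneg ((h t s ht.le hs'.le hs).2.1 i).1 (sub_pos.2 hs').le
  · have h1 := (hasDerivAt_iff_tendsto_slope.1 (hd i)).mono_left
      (nhdsWithin_mono t fun s hs => ne_of_gt hs : 𝓝[>] t ≤ 𝓝[≠] t)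
    refine le_of_tendsto h1 ?_
    filter_upwards [hnear, self_mem_nhdsWithin] with s hs hs'
    rw [slope_def_field, div_le_one (sub_pos.2 hs')]
    exact ((h t s ht.le hs'.le hs).2.1 i).2
  · refine hright i 1 ?_
    filter_upwards [hnear, self_mem_nhdsWithin, (hsmall i).eventually_lt_const hpos]
      with s hs hs' hs''
    rw [one_mul]
    exact (h t s ht.le hs'.le hs).2.2.1 i hs''
  · refine hright i 0 ?_
    filter_upwards [hnear, self_mem_nhdsWithin, (hsmall i).neg.eventually_const_lt
      (by simpa using hneg)] with s hs hs' hs''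
    rw [zero_mul]
    exact (h t s ht.le hs'.le hs).2.2.2.1 i hs''
  have hmain : (fun s => W s - W t - (s - t) • b (W t) - ∑ i, (Γ i s - Γ i t) • c i (W t)) =o[𝓝 t]
      fun s => s - t := by
    have hO : (fun s => W s - W t - (s - t) • b (W t) - ∑ i, (Γ i s - Γ i t) • c i (W t)) =O[𝓝 t]
        fun s => (s - t) ^ 2 := by
      refine Asymptotics.IsBigO.of_bound C ?_
      filter_upwards [Ioo_mem_nhds ht (lt_add_one t)] with s hs
      rw [norm_pow, Real.norm_eq_abs, sq_abs]
      rcases le_total t s with hts | hts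
      · exact (h t s ht.le hts hs.2.le).2.2.2.2.1
      · have := (h s t hs.1.le hts (by linarith)).2.2.2.2.2
        have e : W s - W t - (s - t) • b (W t) - ∑ i, (Γ i s - Γ i t) • c i (W t) =
            -(W t - W s - (t - s) • b (W t) - ∑ i, (Γ i t - Γ i s) • c i (W t)) := by
          simp only [sub_smul, Finset.sum_sub_distrib]
          abel
        rw [e, norm_neg, show (s - t) ^ 2 = (t - s) ^ 2 by ring]
        exact this
    refine hO.trans_isLittleO ?_
    simpa using (Asymptotics.isLittleO_pow_sub_sub t one_lt_two)
  have hder : HasDerivAt (fun s => (s - t) • b (W t) + ∑ i, (Γ i s - Γ i t) • c i (W t))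
      (b (W t) + ∑ i, deriv (Γ i) t • c i (W t)) t := by
    have h1 := ((hasDerivAt_id t).sub_const t).smul_const (b (W t))
    have h2 := HasDerivAt.fun_sum (u := Finset.univ) fun i (_ : i ∈ Finset.univ) =>
      ((hd i).sub_const (Γ i t)).smul_const (c i (W t))
    simpa using h1.fun_add h2
  rw [hasDerivAt_iff_isLittleO] at hder ⊢
  refine (hmain.add hder).congr_left fun s => ?_
  simp only [sub_self, zero_smul, Finset.sum_const_zero, add_zero, sub_zero]
  abel

end existence

lemma network_dist_le (a : Fin m → ℝ) (x : EuclideanSpace ℝ (Fin d)) (W V : Weights m d) :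
    |network a W x - network a V x| ≤
      ((1 / Real.sqrt m) * ∑ r, |a r| * ‖x‖) * ‖W - V‖ := by
  rw [network, network, ← mul_sub, ← Finset.sum_sub_distrib, abs_mul, abs_of_nonneg (by positivity),
    mul_assoc]
  refine mul_le_mul_of_nonneg_left ((Finset.abs_sum_le_sum_abs _ _).trans ?_) (by positivity)
  rw [Finset.sum_mul]
  refine Finset.sum_le_sum fun r _ => ?_
  rw [← mul_sub, abs_mul, mul_assoc]
  refine mul_le_mul_of_nonneg_left ?_ (abs_nonneg _)
  have h := relu_lipschitz.dist_le_mul ⟪W r, x⟫ ⟪V r, x⟫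
  rw [Real.dist_eq, Real.dist_eq, NNReal.coe_one, one_mul, ← inner_sub_left] at h
  refine h.trans ((abs_real_inner_le_norm _ _).trans ?_)
  rw [mul_comm]
  exact mul_le_mul_of_nonneg_left (norm_le_pi_norm (W - V) r) (norm_nonneg _)

/-- Gradient flows of the loss exist from every initialization. -/
theorem exists_isGradientFlow (X : Fin n → EuclideanSpace ℝ (Fin d)) (y : Fin n → ℝ) (lam : ℝ)
    (a : Fin m → ℝ) (W₀ : Weights m d) : ∃ W, IsGradientFlow X y lam a W₀ W := by
  set v : Fin m × Fin n → Weights m d := fun p =>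
    Pi.single p.1 (-((1 / Real.sqrt m) * a p.1) • X p.2) with hv
  set b : Weights m d → Weights m d := fun W => (-lam) • (W - W₀) with hb
  set c : Fin m × Fin n → Weights m d → Weights m d := fun p W =>
    (network a W (X p.2) - y p.2) • v p with hc
  set z : Fin m × Fin n → Weights m d →L[ℝ] ℝ := fun p =>
    (innerSL ℝ (X p.2)).comp (ContinuousLinearMap.proj (R := ℝ)
      (φ := fun _ : Fin m => EuclideanSpace ℝ (Fin d)) p.1) with hz
  have hbL : LipschitzWith (Real.toNNReal |lam|) b := LipschitzWith.of_dist_le_mul fun W V => by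
    rw [dist_eq_norm, dist_eq_norm, hb, Real.coe_toNNReal _ (abs_nonneg _)]
    simp only [← smul_sub, sub_sub_sub_cancel_right, norm_smul, norm_neg, Real.norm_eq_abs, le_refl]
  set κ : Fin m × Fin n → NNReal := fun p =>
    Real.toNNReal (((1 / Real.sqrt m) * ∑ r, |a r| * ‖X p.2‖) * ‖v p‖) with hκ
  have hcL : ∀ p, LipschitzWith (κ p) (c p) := fun p => LipschitzWith.of_dist_le_mul fun W V => by
    rw [dist_eq_norm, dist_eq_norm, hc, hκ, Real.coe_toNNReal _ (by positivity)]
    simp only [← sub_smul, sub_sub_sub_cancel_right, norm_smul, Real.norm_eq_abs]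
    rw [mul_right_comm]
    exact mul_le_mul_of_nonneg_right (network_dist_le a (X p.2) W V) (norm_nonneg _)
  obtain ⟨W, hW0, hac, hW⟩ := exists_solution_of_jumps
    (K := Real.toNNReal |lam| + ∑ p, κ p) (hbL.weaken (by simp))
    (fun p => (hcL p).weaken ((Finset.single_le_sum (f := κ) (fun _ _ => zero_le)
      (Finset.mem_univ p)).trans (by simp))) z W₀
  refine ⟨W, hW0, hac, ?_⟩
  rw [ae_restrict_iff' measurableSet_Ioi]
  filter_upwards [hW] with t ht h0
  obtain ⟨γ, hγ, hd⟩ := ht h0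
  refine ⟨_, ⟨fun r i => γ (r, i), fun r i => ?_, rfl⟩, hd.congr_deriv ?_⟩
  · rw [real_inner_comm]
    exact hγ (r, i)
  · funext r
    rw [Fintype.sum_prod_type, Finset.sum_comm]
    simp only [hb, hc, hv, lossGrad, Pi.add_apply, Pi.neg_apply, Finset.sum_apply, Pi.smul_apply,
      Pi.sub_apply, neg_add, neg_smul]
    rw [add_comm, ← Finset.sum_neg_distrib]
    congr 1
    refine Finset.sum_congr rfl fun i _ => ?_
    rw [Finset.sum_eq_single r (fun r' _ hr' => by simp [hr'.symm]) (by simp), Pi.single_eq_same,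
      smul_neg, smul_neg, smul_smul, smul_smul]
    congr 2
    ring

/-! ### Kernels -/

/-- The pattern `𝟙{w_r ⬝ x ≥ 0}` of active neurons. -/
noncomputable def act (w : Weights m d) (x : EuclideanSpace ℝ (Fin d)) (r : Fin m) : ℝ :=
  if 0 ≤ ⟪w r, x⟫ then 1 else 0

/-- The fraction of neurons whose pre-activation at `x` is at most `R` in absolute value. -/
noncomputable def flipFrac (R : ℝ) (w : Weights m d) (x : EuclideanSpace ℝ (Fin d)) : ℝ :=
  (1 / m) * ∑ r, if |⟪w r, x⟫| ≤ R then (1 : ℝ) else 0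

/-- The tangent kernel of the finite network with activation patterns `h` at `x` and `g` at `x'`. -/
noncomputable def empKernel (h g : Fin m → ℝ) (x x' : EuclideanSpace ℝ (Fin d)) : ℝ :=
  (1 / m) * ∑ r, h r * g r * ⟪x, x'⟫

lemma act_mem (w : Weights m d) (x : EuclideanSpace ℝ (Fin d)) (r : Fin m) :
    act w x r ∈ reluSubdiff ⟪w r, x⟫ :=
  indicator_mem_reluSubdiff _

lemma flipFrac_nonneg (R : ℝ) (w : Weights m d) (x : EuclideanSpace ℝ (Fin d)) :
    0 ≤ flipFrac R w x :=
  mul_nonneg (by positivity) (Finset.sum_nonneg fun r _ => by split_ifs <;> simp)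

lemma sum_mul_inner_eq_normSq (v : Fin n → ℝ) (X : Fin n → EuclideanSpace ℝ (Fin d)) :
    ∑ i, ∑ j, v i * v j * ⟪X i, X j⟫ = ‖∑ i, v i • X i‖ ^ 2 := by
  rw [← real_inner_self_eq_norm_sq, sum_inner]
  refine Finset.sum_congr rfl fun i _ => ?_
  rw [inner_sum]
  refine Finset.sum_congr rfl fun j _ => ?_
  rw [real_inner_smul_left, real_inner_smul_right]
  ring

lemma empKernel_psd (g : Fin m → Fin n → ℝ) (X : Fin n → EuclideanSpace ℝ (Fin d))
    (v : Fin n → ℝ) :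
    0 ≤ ∑ i, ∑ j, v i * v j * empKernel (fun r => g r i) (fun r => g r j) (X i) (X j) := by
  have h : ∑ i, ∑ j, v i * v j * empKernel (fun r => g r i) (fun r => g r j) (X i) (X j) =
      (1 / m) * ∑ r, ‖∑ i, (v i * g r i) • X i‖ ^ 2 := by
    simp_rw [← sum_mul_inner_eq_normSq, empKernel, Finset.mul_sum]
    refine Eq.trans (Finset.sum_congr rfl fun i _ => ?_) Finset.sum_comm
    refine Eq.trans ?_ Finset.sum_comm
    refine Finset.sum_congr rfl fun j _ => Finset.sum_congr rfl fun r _ => ?_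
    ring
  rw [h]
  positivity

lemma measurable_ntk_integrand (x x' : EuclideanSpace ℝ (Fin d)) :
    Measurable (Set.indicator {w : EuclideanSpace ℝ (Fin d) | 0 ≤ ⟪w, x⟫ ∧ 0 ≤ ⟪w, x'⟫}
      (fun _ => ⟪x, x'⟫)) := by
  have h : ∀ u : EuclideanSpace ℝ (Fin d), MeasurableSet {w : EuclideanSpace ℝ (Fin d) | 0 ≤ ⟪w, u⟫} :=
    fun u => measurableSet_le measurable_const (by fun_prop)
  exact measurable_const.indicator ((h x).inter (h x'))

lemma norm_ntk_integrand_le (x x' w : EuclideanSpace ℝ (Fin d)) :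
    ‖Set.indicator {w : EuclideanSpace ℝ (Fin d) | 0 ≤ ⟪w, x⟫ ∧ 0 ≤ ⟪w, x'⟫}
      (fun _ => ⟪x, x'⟫) w‖ ≤ ‖x‖ * ‖x'‖ :=
  (Set.indicator_le_self' (f := fun _ => ‖(⟪x, x'⟫ : ℝ)‖) (fun _ _ => norm_nonneg _) w |>.trans'
    (by rw [norm_indicator_eq_indicator_norm])).trans (norm_inner_le_norm x x')

lemma integrable_ntk_integrand (x x' : EuclideanSpace ℝ (Fin d)) :
    Integrable (Set.indicator {w : EuclideanSpace ℝ (Fin d) | 0 ≤ ⟪w, x⟫ ∧ 0 ≤ ⟪w, x'⟫}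
      (fun _ => ⟪x, x'⟫)) (stdGaussian (EuclideanSpace ℝ (Fin d))) :=
  Integrable.of_bound (measurable_ntk_integrand x x').aestronglyMeasurable (‖x‖ * ‖x'‖)
    (.of_forall fun w => norm_ntk_integrand_le x x' w)

lemma abs_ntk_le (x x' : EuclideanSpace ℝ (Fin d)) : |ntk x x'| ≤ ‖x‖ * ‖x'‖ := by
  have h := norm_integral_le_of_norm_le_const
    (μ := stdGaussian (EuclideanSpace ℝ (Fin d))) (.of_forall fun w => norm_ntk_integrand_le x x' w)
  simpa [ntk] using h

lemma ntk_psd (X : Fin n → EuclideanSpace ℝ (Fin d)) (v : Fin n → ℝ) :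
    0 ≤ ∑ i, ∑ j, v i * v j * ntk (X i) (X j) := by
  simp_rw [ntk, ← integral_const_mul]
  have hi : ∀ i j, Integrable (fun w => v i * v j *
      Set.indicator {w : EuclideanSpace ℝ (Fin d) | 0 ≤ ⟪w, X i⟫ ∧ 0 ≤ ⟪w, X j⟫}
      (fun _ => ⟪X i, X j⟫) w) (stdGaussian (EuclideanSpace ℝ (Fin d))) := fun i j =>
    (integrable_ntk_integrand (X i) (X j)).const_mul _
  simp_rw [← integral_finsetSum _ fun j _ => hi _ j]
  rw [← integral_finsetSum _ fun i _ => integrable_finsetSum _ fun j _ => hi i j]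
  refine integral_nonneg fun w => ?_
  have h : ∀ i j, v i * v j *
      Set.indicator {w : EuclideanSpace ℝ (Fin d) | 0 ≤ ⟪w, X i⟫ ∧ 0 ≤ ⟪w, X j⟫}
      (fun _ => ⟪X i, X j⟫) w =
      (v i * if 0 ≤ ⟪w, X i⟫ then 1 else 0) * (v j * if 0 ≤ ⟪w, X j⟫ then 1 else 0) *
        ⟪X i, X j⟫ := fun i j => by
    by_cases h1 : 0 ≤ ⟪w, X i⟫ <;> by_cases h2 : 0 ≤ ⟪w, X j⟫ <;> simp [Set.indicator, h1, h2]
  simp only [Pi.zero_apply, h]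
  rw [sum_mul_inner_eq_normSq]
  positivity

/-! ### Ridge systems -/

lemma mul_norm_le_of_ridge {Q : Fin n → Fin n → ℝ} {lam : ℝ} {v u : EuclideanSpace ℝ (Fin n)}
    (hQ : ∀ v : Fin n → ℝ, 0 ≤ ∑ i, ∑ j, v i * v j * Q i j)
    (h : ∀ i, ∑ j, Q i j * v j + lam * v i = u i) : lam * ‖v‖ ≤ ‖u‖ := by
  have h1 : lam * ‖v‖ ^ 2 ≤ ⟪v, u⟫ := by
    have e : ⟪v, u⟫ = ∑ i, ∑ j, v i * v j * Q i j + lam * ∑ i, v i ^ 2 := by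
      simp only [PiLp.inner_apply, Finset.mul_sum, ← Finset.sum_add_distrib]
      refine Finset.sum_congr rfl fun i _ => ?_
      rw [← h i, real_inner_eq_re_inner]
      simp only [RCLike.inner_apply, conj_trivial, RCLike.re_to_real, add_mul, Finset.sum_mul]
      congr 1
      · exact Finset.sum_congr rfl fun j _ => by ring
      · ring
    rw [e, EuclideanSpace.real_norm_sq_eq]
    linarith [hQ v]
  have h2 := real_inner_le_norm v u
  rcases (norm_nonneg v).eq_or_lt with h0 | h0
  · rw [← h0]
    simp
  · nlinarith

lemma norm_le_frobenius {D : Fin n → Fin n → ℝ} {α u : EuclideanSpace ℝ (Fin n)} {F : ℝ}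
    (hF : 0 ≤ F) (hD : ∑ i, ∑ j, D i j ^ 2 ≤ F ^ 2) (h : ∀ i, u i = ∑ j, D i j * α j) :
    ‖u‖ ≤ F * ‖α‖ := by
  refine le_of_pow_le_pow_left₀ two_ne_zero (by positivity) ?_
  rw [mul_pow, EuclideanSpace.real_norm_sq_eq, EuclideanSpace.real_norm_sq_eq]
  refine le_trans ?_ (mul_le_mul_of_nonneg_right hD (Finset.sum_nonneg fun i _ => sq_nonneg _))
  rw [Finset.sum_mul]
  refine Finset.sum_le_sum fun i _ => ?_
  rw [h i]
  exact Finset.sum_mul_sq_le_sq_mul_sq _ _ _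

lemma ntkMatrix_ridge_mulVec (X : Fin n → EuclideanSpace ℝ (Fin d)) (lam : ℝ) (v : Fin n → ℝ)
    (i : Fin n) : (ntkMatrix X + lam • (1 : Matrix (Fin n) (Fin n) ℝ)).mulVec v i =
      ∑ j, ntk (X i) (X j) * v j + lam * v i := by
  rw [Matrix.add_mulVec, Matrix.smul_mulVec, Matrix.one_mulVec]
  rfl

lemma ntkMatrix_ridge_isUnit (X : Fin n → EuclideanSpace ℝ (Fin d)) {lam : ℝ} (hlam : 0 < lam) :
    IsUnit (ntkMatrix X + lam • (1 : Matrix (Fin n) (Fin n) ℝ)) := by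
  rw [← Matrix.mulVec_injective_iff_isUnit]
  intro v w hvw
  have h0 := mul_norm_le_of_ridge (lam := lam) (v := WithLp.toLp 2 (v - w)) (u := 0) (ntk_psd X) (by
    intro i
    have h := congrFun (sub_eq_zero.2 hvw) i
    simp only [← Matrix.mulVec_sub, ntkMatrix_ridge_mulVec] at h
    exact h)
  have h1 : ‖WithLp.toLp 2 (v - w)‖ = 0 := by
    rw [norm_zero] at h0
    exact le_antisymm (by nlinarith [norm_nonneg (WithLp.toLp 2 (v - w))]) (norm_nonneg _)
  rw [norm_eq_zero, WithLp.toLp_eq_zero, sub_eq_zero] at h1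
  exact h1

lemma ntkMatrix_ridge_solve (X : Fin n → EuclideanSpace ℝ (Fin d)) (y : Fin n → ℝ) {lam : ℝ}
    (hlam : 0 < lam) (i : Fin n) :
    ∑ j, ntk (X i) (X j) *
        ((ntkMatrix X + lam • (1 : Matrix (Fin n) (Fin n) ℝ))⁻¹.mulVec y) j +
      lam * ((ntkMatrix X + lam • (1 : Matrix (Fin n) (Fin n) ℝ))⁻¹.mulVec y) i = y i := by
  rw [← ntkMatrix_ridge_mulVec, Matrix.mulVec_mulVec, Matrix.mul_nonsing_inv _
    ((Matrix.isUnit_iff_isUnit_det _).1 (ntkMatrix_ridge_isUnit X hlam)), Matrix.one_mulVec]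

/-! ### Stationary points -/

section stationary

lemma abs_sub_act_le {w V x : EuclideanSpace ℝ (Fin d)} {R g : ℝ} (hx : ‖x‖ = 1)
    (hVw : ‖V - w‖ ≤ R) (hg : g ∈ reluSubdiff ⟪V, x⟫) :
    |g - if 0 ≤ ⟪w, x⟫ then 1 else 0| ≤ if |⟪w, x⟫| ≤ R then 1 else 0 := by
  have hb : |⟪V, x⟫ - ⟪w, x⟫| ≤ R := by
    rw [← inner_sub_left]
    refine (abs_real_inner_le_norm _ _).trans ?_
    rwa [hx, mul_one]
  rw [abs_le] at hb
  obtain ⟨h0, h1, hp, hn⟩ := hg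
  by_cases hR : |⟪w, x⟫| ≤ R
  · rw [if_pos hR, abs_le]
    split_ifs <;> constructor <;> linarith
  · rw [if_neg hR]
    rw [not_le, lt_abs] at hR
    rcases hR with h | h
    · have hw : 0 ≤ ⟪w, x⟫ := by linarith [(norm_nonneg (V - w)).trans hVw]
      rw [if_pos hw, hp (by linarith)]
      simp
    · have hw : ¬ 0 ≤ ⟪w, x⟫ := by linarith [(norm_nonneg (V - w)).trans hVw]
      rw [if_neg hw, hn (by linarith)]
      simp

lemma abs_linNet_sub_network_le {w : Weights m d} {a g : Fin m → ℝ}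
    {x : EuclideanSpace ℝ (Fin d)} {R : ℝ} (ha : ∀ r, |a r| = 1)
    (hg : ∀ r, |g r - act w x r| ≤ if |⟪w r, x⟫| ≤ R then 1 else 0) :
    |linNet a g w x - network a w x| ≤ Real.sqrt m * R * flipFrac R w x := by
  rw [network_eq_linNet fun r => mul_eq_relu (act_mem w x r), linNet, linNet, ← mul_sub,
    ← Finset.sum_sub_distrib, abs_mul, abs_of_nonneg (by positivity)]
  have h : |∑ r, (a r * (g r * ⟪w r, x⟫) - a r * (act w x r * ⟪w r, x⟫))| ≤
      R * ∑ r, if |⟪w r, x⟫| ≤ R then (1 : ℝ) else 0 := by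
    refine (Finset.abs_sum_le_sum_abs _ _).trans ?_
    rw [Finset.mul_sum]
    refine Finset.sum_le_sum fun r _ => ?_
    rw [← mul_sub, ← sub_mul, abs_mul, ha, one_mul, abs_mul]
    have := hg r
    split_ifs at this ⊢ with hR
    · nlinarith [abs_nonneg (g r - act w x r), abs_nonneg ⟪w r, x⟫]
    · have h0 : |g r - act w x r| = 0 := le_antisymm this (abs_nonneg _)
      simp [h0]
  refine (mul_le_mul_of_nonneg_left h (by positivity)).trans (le_of_eq ?_)
  rw [flipFrac]
  rcases Nat.eq_zero_or_pos m with rfl | hm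
  · simp
  · have hs : Real.sqrt m ≠ 0 := (Real.sqrt_pos.2 (Nat.cast_pos.2 hm)).ne'
    have hm' : (m : ℝ) = Real.sqrt m * Real.sqrt m := (Real.mul_self_sqrt (Nat.cast_nonneg m)).symm
    generalize (∑ r, if |⟪w r, x⟫| ≤ R then (1 : ℝ) else 0) = A
    generalize Real.sqrt m = s at *
    rw [hm']
    field_simp

lemma abs_empKernel_sub_le {w : Weights m d} {h g : Fin m → ℝ}
    {x x' : EuclideanSpace ℝ (Fin d)} {R : ℝ} (hx : ‖x‖ = 1) (hx' : ‖x'‖ = 1)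
    (hh : ∀ r, |h r - act w x r| ≤ if |⟪w r, x⟫| ≤ R then 1 else 0)
    (hg : ∀ r, |g r - act w x' r| ≤ if |⟪w r, x'⟫| ≤ R then 1 else 0) (hg0 : ∀ r, |g r| ≤ 1) :
    |empKernel h g x x' - empKernel (act w x) (act w x') x x'| ≤
      flipFrac R w x + flipFrac R w x' := by
  rw [empKernel, empKernel, flipFrac, flipFrac, ← mul_add, ← mul_sub, ← Finset.sum_sub_distrib,
    ← Finset.sum_add_distrib, abs_mul, abs_of_nonneg (by positivity)]
  refine mul_le_mul_of_nonneg_left ((Finset.abs_sum_le_sum_abs _ _).trans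
    (Finset.sum_le_sum fun r _ => ?_)) (by positivity)
  have hi : |⟪x, x'⟫| ≤ 1 := by simpa [hx, hx'] using abs_real_inner_le_norm x x'
  have ha : |act w x r| ≤ 1 := by unfold act; split_ifs <;> simp
  have e : h r * g r * ⟪x, x'⟫ - act w x r * act w x' r * ⟪x, x'⟫ =
      ((h r - act w x r) * g r + act w x r * (g r - act w x' r)) * ⟪x, x'⟫ := by ring
  rw [e, abs_mul]
  refine (mul_le_of_le_one_right (abs_nonneg _) hi).trans ((abs_add_le _ _).trans ?_)
  rw [abs_mul, abs_mul]
  exact add_le_add ((mul_le_of_le_one_right (abs_nonneg _) (hg0 r)).trans (hh r))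
    ((mul_le_of_le_one_left (abs_nonneg _) ha).trans (hg r))

variable {X : Fin n → EuclideanSpace ℝ (Fin d)} {y : Fin n → ℝ} {lam : ℝ}
    {a : Fin m → ℝ} {W₀ V : Weights m d} {g : Fin m → Fin n → ℝ}

lemma displacement_of_stationary (h : lossGrad X y lam a W₀ V g = 0) (r : Fin m) :
    lam • (V r - W₀ r) =
      ∑ i, ((y i - network a V (X i)) * ((1 / Real.sqrt m) * a r * g r i)) • X i := by
  have h1 := congrFun h r
  rw [lossGrad, Pi.zero_apply, add_comm, add_eq_zero_iff_eq_neg, ← Finset.sum_neg_distrib] at h1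
  rw [h1]
  refine Finset.sum_congr rfl fun i _ => ?_
  rw [← neg_smul]
  congr 1
  ring

lemma norm_displacement_le (hlam : 0 < lam) (hX : ∀ i, ‖X i‖ = 1) (ha : ∀ r, |a r| = 1)
    (hg : ∀ r i, |g r i| ≤ 1) (h : lossGrad X y lam a W₀ V g = 0) (r : Fin m) :
    lam * ‖V r - W₀ r‖ ≤ (1 / Real.sqrt m) * (Real.sqrt n *
      ‖(WithLp.toLp 2 fun i => y i - network a V (X i) : EuclideanSpace ℝ (Fin n))‖) := by
  have h1 : lam * ‖V r - W₀ r‖ = ‖lam • (V r - W₀ r)‖ := by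
    rw [norm_smul, Real.norm_of_nonneg hlam.le]
  rw [h1, displacement_of_stationary h r]
  have h2 : ‖∑ i, ((y i - network a V (X i)) * ((1 / Real.sqrt m) * a r * g r i)) • X i‖ ≤
      (1 / Real.sqrt m) * ∑ i, |y i - network a V (X i)| := by
    rw [Finset.mul_sum]
    refine norm_sum_le_of_le _ fun i _ => ?_
    rw [norm_smul, hX, mul_one, Real.norm_eq_abs, abs_mul, abs_mul, abs_mul, ha, mul_one,
      abs_of_nonneg (by positivity : 0 ≤ 1 / Real.sqrt m), mul_comm]
    refine mul_le_mul_of_nonneg_right ?_ (abs_nonneg _)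
    exact mul_le_of_le_one_right (by positivity) (hg r i)
  refine h2.trans (mul_le_mul_of_nonneg_left ?_ (by positivity))
  have h3 := Finset.sum_mul_sq_le_sq_mul_sq Finset.univ (fun _ : Fin n => (1 : ℝ))
    fun i => |y i - network a V (X i)|
  refine le_of_pow_le_pow_left₀ two_ne_zero (by positivity) ?_
  rw [mul_pow, Real.sq_sqrt (Nat.cast_nonneg n), EuclideanSpace.real_norm_sq_eq]
  simpa using h3

lemma linNet_of_stationary (ha : ∀ r, |a r| = 1)
    (h : lossGrad X y lam a W₀ V g = 0) (k : Fin m → ℝ) (x : EuclideanSpace ℝ (Fin d)) :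
    lam * (linNet a k V x - linNet a k W₀ x) =
      ∑ i, empKernel k (fun r => g r i) x (X i) * (y i - network a V (X i)) := by
  have e : lam * (linNet a k V x - linNet a k W₀ x) =
      (1 / Real.sqrt m) * ∑ r, a r * (k r * ⟪lam • (V r - W₀ r), x⟫) := by
    rw [linNet, linNet, ← mul_sub, ← Finset.sum_sub_distrib, mul_left_comm, Finset.mul_sum]
    congr 1
    refine Finset.sum_congr rfl fun r _ => ?_
    rw [real_inner_smul_left, inner_sub_left]
    ring
  rw [e]
  simp_rw [displacement_of_stationary h, sum_inner, empKernel, Finset.mul_sum, Finset.sum_mul]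
  rw [Finset.sum_comm]
  refine Finset.sum_congr rfl fun i _ => ?_
  refine Finset.sum_congr rfl fun r _ => ?_
  rw [real_inner_smul_left, real_inner_comm]
  have h1 : a r * a r = 1 := by rw [← abs_mul_abs_self, ha, one_mul]
  have h2 : (1 : ℝ) / m = 1 / Real.sqrt m * (1 / Real.sqrt m) := by
    rw [div_mul_div_comm, one_mul, Real.mul_self_sqrt (Nat.cast_nonneg m)]
  rw [h2]
  linear_combination (1 / Real.sqrt m * (1 / Real.sqrt m) * k r * g r i * ⟪x, X i⟫ *
    (y i - network a V (X i))) * h1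

end stationary

lemma norm_le_of_abs_le {v : EuclideanSpace ℝ (Fin n)} {p : Fin n → ℝ} {C : ℝ}
    (hv : ∀ i, |v i| ≤ p i) (hp : ∑ i, p i ≤ C) : ‖v‖ ≤ C := by
  have hp0 : ∀ i, 0 ≤ p i := fun i => (abs_nonneg _).trans (hv i)
  have h0 : 0 ≤ ∑ i, p i := Finset.sum_nonneg fun i _ => hp0 i
  refine le_trans (le_of_pow_le_pow_left₀ two_ne_zero h0 ?_) hp
  rw [EuclideanSpace.real_norm_sq_eq]
  refine (Finset.sum_le_sum fun i _ => ?_).trans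
    (Finset.sum_sq_le_sq_sum_of_nonneg fun i _ => hp0 i)
  rw [← sq_abs]
  exact pow_le_pow_left₀ (abs_nonneg _) (hv i) 2

lemma norm_le_sqrt_of_abs_le_one {v : EuclideanSpace ℝ (Fin n)} (hv : ∀ i, |v i| ≤ 1) :
    ‖v‖ ≤ Real.sqrt n := by
  refine Real.le_sqrt_of_sq_le ?_
  rw [EuclideanSpace.real_norm_sq_eq]
  refine (Finset.sum_le_sum fun i _ => (sq_le_one_iff_abs_le_one _).2 (hv i)).trans ?_
  simp

lemma abs_sum_mul_le_norm (v w : EuclideanSpace ℝ (Fin n)) : |∑ i, v i * w i| ≤ ‖v‖ * ‖w‖ := by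
  have h := abs_real_inner_le_norm v w
  rw [PiLp.inner_apply] at h
  simpa [mul_comm] using h

variable {X : Fin n → EuclideanSpace ℝ (Fin d)} {y : Fin n → ℝ} {lam : ℝ}
    {a : Fin m → ℝ} {W₀ V : Weights m d} {x : EuclideanSpace ℝ (Fin d)}

lemma norm_residual_le {F : ℝ} (hlam : 0 ≤ lam) (hy : ∀ i, |y i| ≤ 1)
    (hF : ‖(WithLp.toLp 2 fun i => network a W₀ (X i) : EuclideanSpace ℝ (Fin n))‖ ≤ F)
    (hloss : loss X y lam a W₀ V ≤ loss X y lam a W₀ W₀) :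
    ‖(WithLp.toLp 2 fun i => y i - network a V (X i) : EuclideanSpace ℝ (Fin n))‖ ≤
      Real.sqrt n + F := by
  have h1 : ‖(WithLp.toLp 2 fun i => y i - network a V (X i) : EuclideanSpace ℝ (Fin n))‖ ≤
      ‖(WithLp.toLp 2 fun i => y i - network a W₀ (X i) : EuclideanSpace ℝ (Fin n))‖ := by
    refine le_of_pow_le_pow_left₀ two_ne_zero (norm_nonneg _) ?_
    rw [EuclideanSpace.real_norm_sq_eq, EuclideanSpace.real_norm_sq_eq]
    simp only [loss, sub_self, norm_zero] at hloss
    have : 0 ≤ lam / 2 * ∑ r, ‖V r - W₀ r‖ ^ 2 :=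
      mul_nonneg (by positivity) (Finset.sum_nonneg fun _ _ => by positivity)
    simp only [fun i (U : Weights m d) => (sub_sq_comm (y i) (network a U (X i)))]
    simp at hloss
    linarith
  refine h1.trans ?_
  have h2 : (WithLp.toLp 2 fun i => y i - network a W₀ (X i) : EuclideanSpace ℝ (Fin n)) =
      WithLp.toLp 2 y - WithLp.toLp 2 fun i => network a W₀ (X i) := rfl
  rw [h2]
  exact (norm_sub_le _ _).trans (add_le_add (norm_le_sqrt_of_abs_le_one hy) hF)

/-- At a stationary point of the loss the network is close to the NTK predictor, with an error
controlled by the initialization. -/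
theorem abs_network_sub_ntkPredictor_le {R F Fx P Px E Ex : ℝ} (hm : 0 < m) (hlam : 0 < lam)
    (hX : ∀ i, ‖X i‖ = 1) (hx : ‖x‖ = 1) (hy : ∀ i, |y i| ≤ 1) (ha : ∀ r, |a r| = 1)
    (hE0 : 0 ≤ E) (hEx0 : 0 ≤ Ex) (hR0 : 0 ≤ R)
    (hF : ‖(WithLp.toLp 2 fun i => network a W₀ (X i) : EuclideanSpace ℝ (Fin n))‖ ≤ F)
    (hFx : |network a W₀ x| ≤ Fx)
    (hR : Real.sqrt n * (Real.sqrt n + F) ≤ lam * (Real.sqrt m * R))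
    (hP : ∑ i, flipFrac R W₀ (X i) ≤ P) (hPx : flipFrac R W₀ x ≤ Px)
    (hE : ∑ i, ∑ j, (empKernel (act W₀ (X i)) (act W₀ (X j)) (X i) (X j) - ntk (X i) (X j)) ^ 2
      ≤ E ^ 2)
    (hEx : ∑ i, (empKernel (act W₀ x) (act W₀ (X i)) x (X i) - ntk x (X i)) ^ 2 ≤ Ex ^ 2)
    (hloss : loss X y lam a W₀ V ≤ loss X y lam a W₀ W₀)
    (hstat : 0 ∈ lossSubgrad X y lam a W₀ V) :
    |network a V x - ntkPredictor X y lam x| ≤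
      Fx + Real.sqrt m * R * Px + (Ex + (P + n * Px)) * ((Real.sqrt n + F) / lam) +
        Real.sqrt n * ((F + Real.sqrt m * R * P + (E + 2 * n * P) * (Real.sqrt n / lam)) / lam) := by
  obtain ⟨g, hg, hG⟩ := hstat
  have hs : 0 < Real.sqrt m := Real.sqrt_pos.2 (Nat.cast_pos.2 hm)
  set res : EuclideanSpace ℝ (Fin n) := WithLp.toLp 2 fun i => y i - network a V (X i) with hres
  have hresn : ‖res‖ ≤ Real.sqrt n + F := norm_residual_le hlam.le hy hF hloss
  have hg1 : ∀ r i, |g r i| ≤ 1 := fun r i =>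
    abs_le.2 ⟨by linarith [(hg r i).1], (hg r i).2.1⟩
  have hmove : ∀ r, ‖V r - W₀ r‖ ≤ R := fun r => by
    have h1 := norm_displacement_le hlam hX ha hg1 hG.symm r
    have h2 : Real.sqrt n * ‖res‖ ≤ lam * (Real.sqrt m * R) :=
      (mul_le_mul_of_nonneg_left hresn (Real.sqrt_nonneg _)).trans hR
    have h3 : 1 / Real.sqrt m * (Real.sqrt n * ‖res‖) ≤ lam * R := by
      rw [one_div, inv_mul_le_iff₀ hs]
      linarith
    exact le_of_mul_le_mul_left (h1.trans h3) hlam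
  have hgflip : ∀ i r, |g r i - act W₀ (X i) r| ≤ if |⟪W₀ r, X i⟫| ≤ R then 1 else 0 := fun i r =>
    abs_sub_act_le (hX i) (hmove r) (hg r i)
  have hhflip : ∀ r, |act V x r - act W₀ x r| ≤ if |⟪W₀ r, x⟫| ≤ R then 1 else 0 := fun r =>
    abs_sub_act_le hx (hmove r) (act_mem V x r)
  set β : EuclideanSpace ℝ (Fin n) := (1 / lam) • res with hβ
  have hβi : ∀ i, β i = (y i - network a V (X i)) / lam := fun i => by
    simp [hβ, hres, div_eq_inv_mul]
  set α : EuclideanSpace ℝ (Fin n) := WithLp.toLp 2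
    ((ntkMatrix X + lam • (1 : Matrix (Fin n) (Fin n) ℝ))⁻¹.mulVec y) with hα
  have hαeq : ∀ i, ∑ j, ntk (X i) (X j) * α j + lam * α i = y i :=
    ntkMatrix_ridge_solve X y hlam
  have hαn : ‖α‖ ≤ Real.sqrt n / lam := by
    rw [le_div_iff₀ hlam, mul_comm]
    exact (mul_norm_le_of_ridge (u := WithLp.toLp 2 y) (ntk_psd X) hαeq).trans
      (norm_le_sqrt_of_abs_le_one hy)
  have hβn : ‖β‖ ≤ (Real.sqrt n + F) / lam := by
    rw [hβ, norm_smul, Real.norm_of_nonneg (by positivity), one_div, div_eq_inv_mul]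
    exact mul_le_mul_of_nonneg_left hresn (by positivity)
  set H : Fin n → Fin n → ℝ := fun i j =>
    empKernel (fun r => g r i) (fun r => g r j) (X i) (X j) with hH
  set H0 : Fin n → Fin n → ℝ := fun i j =>
    empKernel (act W₀ (X i)) (act W₀ (X j)) (X i) (X j) with hH0
  set b : Fin n → ℝ := fun i => linNet a (fun r => g r i) W₀ (X i) with hb
  have hpred : ∀ (k : Fin m → ℝ) (z : EuclideanSpace ℝ (Fin d)),
      linNet a k V z - linNet a k W₀ z = ∑ i, empKernel k (fun r => g r i) z (X i) * β i :=
    fun k z => by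
      have h := linNet_of_stationary ha hG.symm k z
      rw [mul_comm, ← eq_div_iff hlam.ne', Finset.sum_div] at h
      rw [h]
      exact Finset.sum_congr rfl fun i _ => by rw [hβi, mul_div_assoc]
  have hβeq : ∀ i, ∑ j, H i j * β j + lam * β i = y i - b i := fun i => by
    rw [hH, ← hpred, ← network_eq_linNet fun r => mul_eq_relu (hg r i), hβi,
      mul_div_cancel₀ _ hlam.ne']
    ring
  set p : Fin n → ℝ := fun i => flipFrac R W₀ (X i) with hp
  have hp0 : ∀ i, 0 ≤ p i := fun i => flipFrac_nonneg _ _ _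
  have hP0 : 0 ≤ P := (Finset.sum_nonneg fun i _ => hp0 i).trans hP
  have hbn : ‖(WithLp.toLp 2 b : EuclideanSpace ℝ (Fin n))‖ ≤ F + Real.sqrt m * R * P := by
    have e : (WithLp.toLp 2 b : EuclideanSpace ℝ (Fin n)) =
        (WithLp.toLp 2 fun i => network a W₀ (X i)) +
          WithLp.toLp 2 fun i => b i - network a W₀ (X i) := by
      ext i
      simp
    rw [e]
    refine (norm_add_le _ _).trans (add_le_add hF ?_)
    refine norm_le_of_abs_le (p := fun i => Real.sqrt m * R * p i)
      (fun i => abs_linNet_sub_network_le ha (hgflip i)) ?_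
    rw [← Finset.mul_sum]
    exact mul_le_mul_of_nonneg_left hP (by positivity)
  have hHH0 : ∑ i, ∑ j, (H i j - H0 i j) ^ 2 ≤ (2 * n * P) ^ 2 := by
    have h1 : ∀ i j, (H i j - H0 i j) ^ 2 ≤ (p i + p j) ^ 2 := fun i j => by
      rw [← sq_abs]
      exact pow_le_pow_left₀ (abs_nonneg _) (abs_empKernel_sub_le (hX i) (hX j) (hgflip i)
        (hgflip j) fun r => hg1 r j) 2
    have h2 : ∑ i, ∑ j, (p i + p j) ≤ 2 * n * P := by
      simp only [Finset.sum_add_distrib, Finset.sum_const, Finset.card_univ, Fintype.card_fin,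
        nsmul_eq_mul, ← Finset.mul_sum]
      have := mul_le_mul_of_nonneg_left hP (Nat.cast_nonneg n)
      linarith
    have h3 : 0 ≤ ∑ i, ∑ j, (p i + p j) :=
      Finset.sum_nonneg fun i _ => Finset.sum_nonneg fun j _ => add_nonneg (hp0 i) (hp0 j)
    refine le_trans ?_ (pow_le_pow_left₀ h3 h2 2)
    refine (Finset.sum_le_sum fun i _ => (Finset.sum_le_sum fun j _ => h1 i j).trans
      (Finset.sum_sq_le_sq_sum_of_nonneg fun j _ => add_nonneg (hp0 i) (hp0 j))).trans ?_
    exact Finset.sum_sq_le_sq_sum_of_nonneg fun i _ =>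
      Finset.sum_nonneg fun j _ => add_nonneg (hp0 i) (hp0 j)
  have hdiffn : lam * ‖β - α‖ ≤
      F + Real.sqrt m * R * P + (E + 2 * n * P) * (Real.sqrt n / lam) := by
    set e1 : EuclideanSpace ℝ (Fin n) :=
      WithLp.toLp 2 fun i => ∑ j, (H0 i j - ntk (X i) (X j)) * α j with he1
    set e2 : EuclideanSpace ℝ (Fin n) :=
      WithLp.toLp 2 fun i => ∑ j, (H i j - H0 i j) * α j with he2
    have h1 : ‖e1‖ ≤ E * ‖α‖ := norm_le_frobenius hE0 hE fun i => rfl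
    have h2 : ‖e2‖ ≤ 2 * n * P * ‖α‖ := norm_le_frobenius (by positivity) hHH0 fun i => rfl
    have h3 := mul_norm_le_of_ridge (Q := H) (lam := lam) (v := β - α)
      (u := -(WithLp.toLp 2 b) - e1 - e2) (empKernel_psd g X) (fun i => by
        simp only [PiLp.sub_apply, PiLp.neg_apply, he1, he2, mul_sub, sub_mul,
          Finset.sum_sub_distrib]
        linarith [hβeq i, hαeq i])
    have h4 : ‖-(WithLp.toLp 2 b : EuclideanSpace ℝ (Fin n)) - e1 - e2‖ ≤
        ‖(WithLp.toLp 2 b : EuclideanSpace ℝ (Fin n))‖ + ‖e1‖ + ‖e2‖ := by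
      refine (norm_sub_le _ _).trans (add_le_add_left ((norm_sub_le _ _).trans ?_) _)
      rw [norm_neg]
    have h5 : (E + 2 * n * P) * ‖α‖ ≤ (E + 2 * n * P) * (Real.sqrt n / lam) :=
      mul_le_mul_of_nonneg_left hαn (by positivity)
    linarith
  set k : EuclideanSpace ℝ (Fin n) := WithLp.toLp 2 fun i =>
    empKernel (act V x) (fun r => g r i) x (X i) with hk
  set k0 : EuclideanSpace ℝ (Fin n) := WithLp.toLp 2 fun i =>
    empKernel (act W₀ x) (act W₀ (X i)) x (X i) with hk0
  set K : EuclideanSpace ℝ (Fin n) := WithLp.toLp 2 fun i => ntk x (X i) with hK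
  have hkn : ‖k - K‖ ≤ Ex + (P + n * Px) := by
    have h1 : ‖k0 - K‖ ≤ Ex := by
      refine le_of_pow_le_pow_left₀ two_ne_zero hEx0 ?_
      rw [EuclideanSpace.real_norm_sq_eq]
      exact hEx
    have h2 : ‖k - k0‖ ≤ P + n * Px := by
      refine norm_le_of_abs_le (p := fun i => flipFrac R W₀ x + p i)
        (fun i => abs_empKernel_sub_le hx (hX i) hhflip (hgflip i) fun r => hg1 r i) ?_
      rw [Finset.sum_add_distrib, Finset.sum_const, Finset.card_univ, Fintype.card_fin,
        nsmul_eq_mul]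
      linarith [mul_le_mul_of_nonneg_left hPx (Nat.cast_nonneg n)]
    have h3 := norm_sub_le_norm_sub_add_norm_sub k k0 K
    linarith
  have hKn : ‖K‖ ≤ Real.sqrt n := norm_le_sqrt_of_abs_le_one fun i => by
    simpa [hx, hX] using abs_ntk_le x (X i)
  have hmain : network a V x - ntkPredictor X y lam x =
      linNet a (act V x) W₀ x + ∑ i, (k - K) i * β i + ∑ i, K i * (β - α) i := by
    have h1 := hpred (act V x) x
    rw [← network_eq_linNet fun r => mul_eq_relu (act_mem V x r), sub_eq_iff_eq_add] at h1
    rw [h1]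
    simp only [ntkPredictor, dotProduct, PiLp.sub_apply, mul_sub, sub_mul, Finset.sum_sub_distrib,
      hk, hK, hα]
    ring
  have hlin : |linNet a (act V x) W₀ x| ≤ Fx + Real.sqrt m * R * Px := by
    have h1 := abs_linNet_sub_network_le ha hhflip
    have h2 := mul_le_mul_of_nonneg_left hPx (by positivity : 0 ≤ Real.sqrt m * R)
    have h3 := abs_add_le (linNet a (act V x) W₀ x - network a W₀ x) (network a W₀ x)
    rw [sub_add_cancel] at h3
    linarith
  rw [hmain]
  refine (abs_add_three _ _ _).trans (add_le_add (add_le_add hlin ?_) ?_)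
  · refine (abs_sum_mul_le_norm _ _).trans (mul_le_mul hkn hβn (norm_nonneg _) ?_)
    exact (norm_nonneg _).trans hkn
  · refine (abs_sum_mul_le_norm _ _).trans (mul_le_mul hKn ?_ (norm_nonneg _) (Real.sqrt_nonneg _))
    rw [le_div_iff₀ hlam, mul_comm]
    exact hdiffn

/-! ### The Gaussian weights -/

/-- The law `N(0, κ² I_d)` of a single initial weight. -/
noncomputable abbrev gaussLaw (d : ℕ) (κ : ℝ) : Measure (EuclideanSpace ℝ (Fin d)) :=
  multivariateGaussian 0 (κ ^ 2 • (1 : Matrix (Fin d) (Fin d) ℝ))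

lemma gaussLaw_eq_map (d : ℕ) (κ : ℝ) :
    gaussLaw d κ = (stdGaussian (EuclideanSpace ℝ (Fin d))).map (fun w => κ • w) := by
  have hS : (κ ^ 2 • (1 : Matrix (Fin d) (Fin d) ℝ)).PosSemidef :=
    Matrix.PosSemidef.one.smul (sq_nonneg κ)
  have : IsProbabilityMeasure
      ((stdGaussian (EuclideanSpace ℝ (Fin d))).map (fun w => κ • w)) :=
    Measure.isProbabilityMeasure_map (by fun_prop)
  refine Measure.ext_of_charFun (funext fun t => ?_)
  rw [charFun_multivariateGaussian hS, charFun_map_smul, charFun_stdGaussian]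
  congr 1
  rw [← Complex.ofReal_pow, norm_smul, mul_pow, Real.norm_eq_abs, sq_abs,
    EuclideanSpace.real_norm_sq_eq]
  simp only [inner_zero_right, Matrix.smul_mulVec, Matrix.one_mulVec, dotProduct]
  push_cast
  simp only [zero_mul, zero_sub, neg_div, Finset.mul_sum, Pi.smul_apply, smul_eq_mul]
  push_cast
  refine congrArg (fun u : ℂ => -(u / 2)) (Finset.sum_congr rfl fun i _ => ?_)
  ring

lemma map_inner_stdGaussian {x : EuclideanSpace ℝ (Fin d)} (hx : ‖x‖ = 1) :
    (stdGaussian (EuclideanSpace ℝ (Fin d))).map (fun w => ⟪w, x⟫) = gaussianReal 0 1 := by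
  have h := IsGaussian.map_eq_gaussianReal (μ := stdGaussian (EuclideanSpace ℝ (Fin d)))
    (innerSL ℝ x)
  rw [variance_dual_stdGaussian, integral_strongDual_stdGaussian, innerSL_apply_norm, hx] at h
  simpa [real_inner_comm] using h

lemma map_inner_gaussLaw {x : EuclideanSpace ℝ (Fin d)} (hx : ‖x‖ = 1) (κ : ℝ) :
    (gaussLaw d κ).map (fun w => ⟪w, x⟫) = (gaussianReal 0 1).map (fun t => κ * t) := by
  rw [gaussLaw_eq_map, Measure.map_map (by fun_prop) (by fun_prop), ← map_inner_stdGaussian hx,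
    Measure.map_map (by fun_prop) (by fun_prop)]
  congr 1
  funext w
  simp [real_inner_smul_left]

lemma lintegral_sq_gaussianReal :
    ∫⁻ t, ENNReal.ofReal (t ^ 2) ∂(gaussianReal 0 1) = 1 := by
  have h := evariance_eq_lintegral_ofReal (X := id) (μ := gaussianReal 0 1)
  rw [← ofReal_variance IsGaussian.memLp_two_id, variance_id_gaussianReal] at h
  simpa using h.symm

lemma lintegral_sq_inner_gaussLaw {x : EuclideanSpace ℝ (Fin d)} (hx : ‖x‖ = 1) (κ : ℝ) :
    ∫⁻ w, ENNReal.ofReal (⟪w, x⟫ ^ 2) ∂(gaussLaw d κ) = ENNReal.ofReal (κ ^ 2) := by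
  rw [← lintegral_map (f := fun t => ENNReal.ofReal (t ^ 2)) (g := fun w => ⟪w, x⟫) (by fun_prop)
    (by fun_prop), map_inner_gaussLaw hx, lintegral_map (by fun_prop) (by fun_prop)]
  simp_rw [mul_pow, ENNReal.ofReal_mul (sq_nonneg κ)]
  rw [lintegral_const_mul _ (by fun_prop), lintegral_sq_gaussianReal, mul_one]

lemma gaussianReal_Icc_le (ρ : ℝ) :
    gaussianReal 0 1 (Set.Icc (-ρ) ρ) ≤ ENNReal.ofReal ρ := by
  rw [gaussianReal_apply _ one_ne_zero]
  have hpdf : ∀ t, gaussianPDF 0 1 t ≤ ENNReal.ofReal (1 / 2) := fun t => by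
    refine ENNReal.ofReal_le_ofReal ?_
    rw [gaussianPDFReal, one_div]
    refine (mul_le_of_le_one_right (by positivity) (Real.exp_le_one_iff.2 ?_)).trans ?_
    · rw [neg_div]
      exact neg_nonpos.2 (by positivity)
    · refine inv_anti₀ two_pos (Real.le_sqrt_of_sq_le ?_)
      have := Real.pi_gt_three
      simp only [NNReal.coe_one, mul_one]
      linarith
  calc ∫⁻ t in Set.Icc (-ρ) ρ, gaussianPDF 0 1 t
      ≤ ∫⁻ _ in Set.Icc (-ρ) ρ, ENNReal.ofReal (1 / 2) := lintegral_mono fun t => hpdf t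
    _ = ENNReal.ofReal ρ := by
      rw [setLIntegral_const, Real.volume_Icc, ← ENNReal.ofReal_mul (by norm_num)]
      congr 1
      ring

lemma gaussLaw_small_ball {x : EuclideanSpace ℝ (Fin d)} (hx : ‖x‖ = 1) {κ : ℝ} (hκ : 0 < κ)
    (R : ℝ) : gaussLaw d κ {w | |⟪w, x⟫| ≤ R} ≤ ENNReal.ofReal (R / κ) := by
  have hms : MeasurableSet {t : ℝ | |t| ≤ R} := measurableSet_le (by fun_prop) (by fun_prop)
  have h1 : gaussLaw d κ {w | |⟪w, x⟫| ≤ R} =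
      (gaussLaw d κ).map (fun w => ⟪w, x⟫) {t : ℝ | |t| ≤ R} := by
    rw [Measure.map_apply (by fun_prop) hms]
    rfl
  rw [h1, map_inner_gaussLaw hx, Measure.map_apply (by fun_prop) hms]
  refine le_trans (measure_mono fun t ht => ?_) (gaussianReal_Icc_le (R / κ))
  have ht' : |κ * t| ≤ R := ht
  rw [abs_mul, abs_of_pos hκ] at ht'
  rw [Set.mem_Icc, ← abs_le, le_div_iff₀ hκ]
  linarith

lemma integral_ntk_integrand_gaussLaw {κ : ℝ} (hκ : 0 < κ) (x x' : EuclideanSpace ℝ (Fin d)) :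
    ∫ w, Set.indicator {w : EuclideanSpace ℝ (Fin d) | 0 ≤ ⟪w, x⟫ ∧ 0 ≤ ⟪w, x'⟫}
      (fun _ => ⟪x, x'⟫) w ∂(gaussLaw d κ) = ntk x x' := by
  rw [gaussLaw_eq_map, integral_map (by fun_prop)
    (measurable_ntk_integrand x x').aestronglyMeasurable, ntk]
  congr 1
  funext w
  simp [Set.indicator, real_inner_smul_left, mul_nonneg_iff_of_pos_left hκ]

/-! ### Second moments of empirical means -/

lemma lintegral_sq_empirical_mean_le {Ω : Type*} [MeasurableSpace Ω] {μ : Measure Ω}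
    [IsProbabilityMeasure μ] {φ : Ω → ℝ} (hφ : Measurable φ) (hb : ∀ ω, |φ ω| ≤ 1) (hm : 0 < m) :
    ∫⁻ ω, ENNReal.ofReal (((1 / m) * ∑ r : Fin m, φ (ω r) - ∫ ω, φ ω ∂μ) ^ 2)
      ∂(Measure.pi fun _ : Fin m => μ) ≤ ENNReal.ofReal (1 / m) := by
  have hm' : (m : ℝ) ≠ 0 := (Nat.cast_pos.2 hm).ne'
  have hL : MemLp φ 2 μ := MemLp.of_bound hφ.aestronglyMeasurable 1 (.of_forall hb)
  have hφr : ∀ r : Fin m, MemLp (fun ω : Fin m → Ω => φ (ω r)) 2 (Measure.pi fun _ => μ) :=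
    fun r => hL.comp_measurePreserving (measurePreserving_eval _ r)
  set Z : (Fin m → Ω) → ℝ := fun ω => (1 / m) * ∑ r : Fin m, φ (ω r) with hZ
  have hZL : MemLp Z 2 (Measure.pi fun _ => μ) :=
    (memLp_finsetSum _ fun r _ => hφr r).const_mul _
  have hmean : ∫ ω, Z ω ∂(Measure.pi fun _ => μ) = ∫ ω, φ ω ∂μ := by
    rw [hZ, integral_const_mul, integral_finsetSum _ fun r _ => (hφr r).integrable one_le_two]
    simp_rw [integral_comp_eval (μ := fun _ : Fin m => μ) hφ.aestronglyMeasurable]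
    simp [hm']
  have hvar : Var[Z; Measure.pi fun _ => μ] ≤ 1 / m := by
    rw [hZ, variance_const_mul]
    have h1 := variance_sum_pi (μ := fun _ : Fin m => μ) (X := fun _ => φ) fun _ => hL
    have h2 : (∑ r : Fin m, fun ω : Fin m → Ω => φ (ω r)) = fun ω => ∑ r, φ (ω r) := by
      funext ω
      simp
    rw [h2] at h1
    rw [h1]
    have h3 : Var[φ; μ] ≤ 1 := by
      refine (variance_le_expectation_sq hφ.aestronglyMeasurable).trans ?_
      have h4 := norm_integral_le_of_norm_le_const (μ := μ) (f := φ ^ 2) (C := 1)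
        (.of_forall fun ω => by
          rw [Pi.pow_apply, norm_pow]
          exact pow_le_one₀ (norm_nonneg _) (hb ω))
      rw [probReal_univ, mul_one] at h4
      exact (le_abs_self _).trans h4
    rw [Finset.sum_const, Finset.card_univ, Fintype.card_fin, nsmul_eq_mul]
    have : (1 / (m : ℝ)) ^ 2 * (m * Var[φ; μ]) = 1 / m * Var[φ; μ] := by field_simp
    rw [this]
    exact mul_le_of_le_one_right (by positivity) h3
  have h := evariance_eq_lintegral_ofReal (X := Z) (μ := Measure.pi fun _ => μ)
  rw [← ofReal_variance hZL, hmean] at h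
  rw [← h]
  exact ENNReal.ofReal_le_ofReal hvar

lemma uniformOn_signs_eq : uniformOn ({-1, 1} : Set ℝ) =
    (2 : ENNReal)⁻¹ • (Measure.dirac (-1) + Measure.dirac 1) := by
  have hne : (-1 : ℝ) ∉ ({1} : Set ℝ) := by norm_num
  have hc : Measure.count ({-1, 1} : Set ℝ) = 2 := by
    have h := Measure.count_apply_finset ({-1, 1} : Finset ℝ)
    rw [Finset.card_pair (by norm_num)] at h
    simpa using h
  rw [uniformOn, ProbabilityTheory.cond, hc, Set.insert_eq, Measure.restrict_union (by simpa using hne)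
    (measurableSet_singleton _), Measure.restrict_singleton, Measure.restrict_singleton]
  simp

instance isProbabilityMeasure_signs : IsProbabilityMeasure (uniformOn ({-1, 1} : Set ℝ)) :=
  isProbabilityMeasure_uniformOn (by simp) (by simp)

lemma ae_abs_eq_one_signs : ∀ᵐ s ∂(uniformOn ({-1, 1} : Set ℝ)), |s| = 1 := by
  rw [uniformOn_signs_eq]
  refine Measure.ae_smul_measure ?_ _
  rw [ae_add_measure_iff]
  constructor <;> rw [ae_dirac_iff (measurableSet_eq_fun (by fun_prop) (by fun_prop))] <;> simp

lemma memLp_signs : MemLp (fun s : ℝ => s) 2 (uniformOn ({-1, 1} : Set ℝ)) := by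
  refine MemLp.of_bound measurable_id.aestronglyMeasurable 1 ?_
  filter_upwards [ae_abs_eq_one_signs] with s hs using hs.le

lemma integral_signs : ∫ s, s ∂(uniformOn ({-1, 1} : Set ℝ)) = 0 := by
  rw [uniformOn_signs_eq, integral_smul_measure, integral_add_measure
    (integrable_dirac (by simp)) (integrable_dirac (by simp))]
  simp

lemma variance_signs : Var[fun s => s; uniformOn ({-1, 1} : Set ℝ)] = 1 := by
  rw [variance_of_integral_eq_zero (X := fun s : ℝ => s) measurable_id.aemeasurable integral_signs]
  have : ∫ s, s ^ 2 ∂(uniformOn ({-1, 1} : Set ℝ)) =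
      ∫ _, (1 : ℝ) ∂(uniformOn ({-1, 1} : Set ℝ)) := by
    refine integral_congr_ae ?_
    filter_upwards [ae_abs_eq_one_signs] with s hs
    rw [← sq_abs, hs, one_pow]
  rw [this]
  simp

lemma lintegral_sq_rademacher (c : Fin m → ℝ) :
    ∫⁻ a, ENNReal.ofReal ((∑ r, a r * c r) ^ 2)
      ∂(Measure.pi fun _ : Fin m => uniformOn ({-1, 1} : Set ℝ)) =
        ENNReal.ofReal (∑ r, c r ^ 2) := by
  set μ := uniformOn ({-1, 1} : Set ℝ) with hμ
  have hL : ∀ r, MemLp (fun s : ℝ => s * c r) 2 μ := fun r => memLp_signs.mul_const _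
  have hLr : ∀ r, MemLp (fun a : Fin m → ℝ => a r * c r) 2 (Measure.pi fun _ => μ) :=
    fun r => (hL r).comp_measurePreserving (measurePreserving_eval _ r)
  set Z : (Fin m → ℝ) → ℝ := fun a => ∑ r, a r * c r with hZ
  have hZL : MemLp Z 2 (Measure.pi fun _ => μ) := memLp_finsetSum _ fun r _ => hLr r
  have hmean : ∫ a, Z a ∂(Measure.pi fun _ => μ) = 0 := by
    rw [hZ, integral_finsetSum _ fun r _ => (hLr r).integrable one_le_two]
    refine Finset.sum_eq_zero fun r _ => ?_
    rw [integral_comp_eval (μ := fun _ : Fin m => μ) (f := fun s : ℝ => s * c r)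
      (by fun_prop), integral_mul_const, integral_signs, zero_mul]
  have hvar : Var[Z; Measure.pi fun _ => μ] = ∑ r, c r ^ 2 := by
    have h1 := variance_sum_pi (μ := fun _ : Fin m => μ) (X := fun r s => s * c r) hL
    have h2 : (∑ r : Fin m, fun a : Fin m → ℝ => a r * c r) = Z := by
      funext a
      simp [hZ]
    rw [h2] at h1
    rw [h1]
    refine Finset.sum_congr rfl fun r _ => ?_
    rw [variance_mul_const, variance_signs, one_mul]
  have h := evariance_eq_lintegral_ofReal (X := Z) (μ := Measure.pi fun _ => μ)
  rw [← ofReal_variance hZL, hmean, hvar] at h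
  simpa using h.symm

/-! ### The random initialization -/

instance isProbabilityMeasure_initLaw (m d : ℕ) (κ : ℝ) : IsProbabilityMeasure (initLaw m d κ) := by
  unfold initLaw
  infer_instance

lemma lintegral_initLaw_fst {κ : ℝ} {f : Weights m d → ENNReal} (hf : Measurable f) :
    ∫⁻ θ, f θ.1 ∂(initLaw m d κ) = ∫⁻ w, f w ∂(Measure.pi fun _ : Fin m => gaussLaw d κ) := by
  rw [initLaw]
  exact measurePreserving_fst.lintegral_comp hf

lemma ae_abs_signs_initLaw (m d : ℕ) (κ : ℝ) : ∀ᵐ θ ∂(initLaw m d κ), ∀ r, |θ.2 r| = 1 := by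
  rw [ae_all_iff]
  intro r
  rw [initLaw]
  exact ((measurePreserving_eval (fun _ : Fin m => uniformOn ({-1, 1} : Set ℝ)) r).comp
    measurePreserving_snd).quasiMeasurePreserving.ae ae_abs_eq_one_signs

@[fun_prop]
lemma measurable_network (x : EuclideanSpace ℝ (Fin d)) :
    Measurable fun θ : Weights m d × (Fin m → ℝ) => network θ.2 θ.1 x := by
  unfold network
  have := continuous_relu.measurable
  fun_prop

@[fun_prop]
lemma measurable_flipFrac (R : ℝ) (x : EuclideanSpace ℝ (Fin d)) :
    Measurable fun w : Weights m d => flipFrac R w x := by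
  unfold flipFrac
  refine Measurable.const_mul (Finset.measurable_sum _ fun r _ => ?_) _
  exact Measurable.ite (measurableSet_le (by fun_prop) (by fun_prop)) (by fun_prop) (by fun_prop)

@[fun_prop]
lemma measurable_act (x : EuclideanSpace ℝ (Fin d)) (r : Fin m) :
    Measurable fun w : Weights m d => act w x r := by
  unfold act
  exact Measurable.ite (measurableSet_le (by fun_prop) (by fun_prop)) (by fun_prop) (by fun_prop)

@[fun_prop]
lemma measurable_empKernel (x x' : EuclideanSpace ℝ (Fin d)) :
    Measurable fun w : Weights m d => empKernel (act w x) (act w x') x x' := by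
  unfold empKernel
  fun_prop

lemma lintegral_network_sq_le {x : EuclideanSpace ℝ (Fin d)} (hx : ‖x‖ = 1) (κ : ℝ) :
    ∫⁻ θ, ENNReal.ofReal (network θ.2 θ.1 x ^ 2) ∂(initLaw m d κ) ≤ ENNReal.ofReal (κ ^ 2) := by
  rw [initLaw, lintegral_prod _
    ((measurable_network x).pow_const 2).ennreal_ofReal.aemeasurable]
  have h1 : ∀ w : Weights m d, ∫⁻ a, ENNReal.ofReal (network a w x ^ 2)
      ∂(Measure.pi fun _ : Fin m => uniformOn ({-1, 1} : Set ℝ)) ≤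
      ENNReal.ofReal (1 / m) * ∑ r, ENNReal.ofReal (⟪w r, x⟫ ^ 2) := fun w => by
    have e : ∀ a, ENNReal.ofReal (network a w x ^ 2) = ENNReal.ofReal (1 / m) *
        ENNReal.ofReal ((∑ r, a r * relu ⟪w r, x⟫) ^ 2) := fun a => by
      rw [network, mul_pow, div_pow, one_pow, Real.sq_sqrt (Nat.cast_nonneg m),
        ENNReal.ofReal_mul (by positivity)]
    simp_rw [e]
    rw [lintegral_const_mul _ (by fun_prop), lintegral_sq_rademacher,
      ENNReal.ofReal_sum_of_nonneg fun _ _ => sq_nonneg _]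
    refine mul_le_mul_right (Finset.sum_le_sum fun r _ => ENNReal.ofReal_le_ofReal ?_) _
    rw [← sq_abs, ← sq_abs ⟪w r, x⟫]
    refine pow_le_pow_left₀ (abs_nonneg _) ?_ 2
    have := relu_lipschitz.dist_le_mul ⟪w r, x⟫ 0
    simpa [Real.dist_eq, relu] using this
  refine (lintegral_mono h1).trans ?_
  rw [lintegral_const_mul _ (by fun_prop), lintegral_finsetSum _ fun r _ => by fun_prop]
  have h2 : ∀ r : Fin m, ∫⁻ w : Weights m d, ENNReal.ofReal (⟪w r, x⟫ ^ 2)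
      ∂(Measure.pi fun _ : Fin m => gaussLaw d κ) = ENNReal.ofReal (κ ^ 2) := fun r => by
    rw [← lintegral_sq_inner_gaussLaw hx κ]
    exact (measurePreserving_eval (fun _ : Fin m => gaussLaw d κ) r).lintegral_comp
      (f := fun v => ENNReal.ofReal (⟪v, x⟫ ^ 2)) (by fun_prop)
  simp_rw [h2]
  rw [Finset.sum_const, Finset.card_univ, Fintype.card_fin, nsmul_eq_mul, ← mul_assoc,
    ← ENNReal.ofReal_natCast, ← ENNReal.ofReal_mul (by positivity)]
  refine mul_le_of_le_one_left zero_le ?_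
  rw [ENNReal.ofReal_le_one, one_div]
  exact inv_mul_le_one

lemma lintegral_flipFrac_le {x : EuclideanSpace ℝ (Fin d)} (hx : ‖x‖ = 1) {κ : ℝ} (hκ : 0 < κ)
    (R : ℝ) :
    ∫⁻ θ, ENNReal.ofReal (flipFrac R θ.1 x) ∂(initLaw m d κ) ≤ ENNReal.ofReal (R / κ) := by
  rw [lintegral_initLaw_fst (f := fun w => ENNReal.ofReal (flipFrac R w x)) (by fun_prop)]
  have hms : MeasurableSet {v : EuclideanSpace ℝ (Fin d) | |⟪v, x⟫| ≤ R} :=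
    measurableSet_le (by fun_prop) (by fun_prop)
  have e : ∀ w : Weights m d, ENNReal.ofReal (flipFrac R w x) = ENNReal.ofReal (1 / m) *
      ∑ r, Set.indicator {v : EuclideanSpace ℝ (Fin d) | |⟪v, x⟫| ≤ R} 1 (w r) := fun w => by
    rw [flipFrac, ENNReal.ofReal_mul (by positivity), ENNReal.ofReal_sum_of_nonneg
      fun r _ => by split_ifs <;> simp]
    congr 1
    refine Finset.sum_congr rfl fun r _ => ?_
    by_cases h : |⟪w r, x⟫| ≤ R <;> simp [h]
  have hind : Measurable (Set.indicator {v : EuclideanSpace ℝ (Fin d) | |⟪v, x⟫| ≤ R}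
      (1 : EuclideanSpace ℝ (Fin d) → ENNReal)) := measurable_one.indicator hms
  have hindr : ∀ r : Fin m, Measurable fun w : Weights m d =>
      Set.indicator {v : EuclideanSpace ℝ (Fin d) | |⟪v, x⟫| ≤ R}
        (1 : EuclideanSpace ℝ (Fin d) → ENNReal) (w r) := fun r =>
    hind.comp (measurable_pi_apply r)
  simp_rw [e]
  rw [lintegral_const_mul _ (Finset.measurable_sum _ fun r _ => hindr r),
    lintegral_finsetSum _ fun r _ => hindr r]
  have h2 : ∀ r : Fin m, ∫⁻ w : Weights m d,
      Set.indicator {v : EuclideanSpace ℝ (Fin d) | |⟪v, x⟫| ≤ R} 1 (w r)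
      ∂(Measure.pi fun _ : Fin m => gaussLaw d κ) ≤ ENNReal.ofReal (R / κ) := fun r => by
    refine le_trans (le_of_eq ?_) (gaussLaw_small_ball hx hκ R)
    rw [← lintegral_indicator_one hms]
    exact (measurePreserving_eval (fun _ : Fin m => gaussLaw d κ) r).lintegral_comp hind
  refine (mul_le_mul_right (Finset.sum_le_sum fun r _ => h2 r) _).trans ?_
  rw [Finset.sum_const, Finset.card_univ, Fintype.card_fin, nsmul_eq_mul, ← mul_assoc,
    ← ENNReal.ofReal_natCast, ← ENNReal.ofReal_mul (by positivity)]
  refine mul_le_of_le_one_left zero_le ?_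
  rw [ENNReal.ofReal_le_one, one_div]
  exact inv_mul_le_one

lemma lintegral_empKernel_sub_sq_le {x x' : EuclideanSpace ℝ (Fin d)} (hx : ‖x‖ = 1)
    (hx' : ‖x'‖ = 1) {κ : ℝ} (hκ : 0 < κ) (hm : 0 < m) :
    ∫⁻ θ, ENNReal.ofReal ((empKernel (act θ.1 x) (act θ.1 x') x x' - ntk x x') ^ 2)
      ∂(initLaw m d κ) ≤ ENNReal.ofReal (1 / m) := by
  rw [lintegral_initLaw_fst (f := fun w : Weights m d =>
    ENNReal.ofReal ((empKernel (act w x) (act w x') x x' - ntk x x') ^ 2)) (by fun_prop)]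
  have h := lintegral_sq_empirical_mean_le (μ := gaussLaw d κ) (measurable_ntk_integrand x x')
    (fun w => (norm_ntk_integrand_le x x' w).trans (by rw [hx, hx', one_mul])) hm
  rw [integral_ntk_integrand_gaussLaw hκ] at h
  refine le_trans (le_of_eq ?_) h
  refine lintegral_congr fun w => ?_
  rw [empKernel]
  congr 4
  refine Finset.sum_congr rfl fun r _ => ?_
  by_cases h1 : 0 ≤ ⟪w r, x⟫ <;> by_cases h2 : 0 ≤ ⟪w r, x'⟫ <;> simp [act, Set.indicator, h1, h2]

/-- Markov's inequality for finitely many nonnegative functions simultaneously. -/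
lemma exists_event_of_lintegral_le_one {Ω ι : Type*} [Fintype ι] [MeasurableSpace Ω]
    {μ : Measure Ω} [IsProbabilityMeasure μ] {T : ι → Ω → ℝ} (hT : ∀ k, Measurable (T k))
    (h1 : ∀ k, ∫⁻ ω, ENNReal.ofReal (T k ω) ∂μ ≤ 1) {δ : ℝ} (hδ : 0 < δ) :
    ENNReal.ofReal (1 - δ) ≤ μ {ω | ∀ k, T k ω ≤ Fintype.card ι / δ} := by
  have hms : MeasurableSet {ω | ∀ k, T k ω ≤ Fintype.card ι / δ} := by
    rw [Set.ofPred_forall]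
    exact MeasurableSet.iInter fun k => measurableSet_le (hT k) measurable_const
  rcases isEmpty_or_nonempty ι with hι | hι
  · simp [hδ.le]
  have hc : (0 : ℝ) < Fintype.card ι / δ := div_pos (Nat.cast_pos.2 Fintype.card_pos) hδ
  have h2 : ENNReal.ofReal (Fintype.card ι / δ) * μ {ω | ∀ k, T k ω ≤ Fintype.card ι / δ}ᶜ ≤
      Fintype.card ι := by
    calc _ ≤ ENNReal.ofReal (Fintype.card ι / δ) *
          μ {ω | ENNReal.ofReal (Fintype.card ι / δ) ≤ ∑ k, ENNReal.ofReal (T k ω)} := by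
          refine mul_le_mul_right (measure_mono fun ω hω => ?_) _
          simp only [Set.mem_compl_iff, Set.mem_ofPred_eq, not_forall, not_le] at hω
          obtain ⟨k, hk⟩ := hω
          exact (ENNReal.ofReal_le_ofReal hk.le).trans
            (Finset.single_le_sum (f := fun k => ENNReal.ofReal (T k ω)) (fun _ _ => zero_le)
              (Finset.mem_univ k))
      _ ≤ ∫⁻ ω, ∑ k, ENNReal.ofReal (T k ω) ∂μ :=
          mul_meas_ge_le_lintegral (Finset.measurable_sum _ fun k _ => (hT k).ennreal_ofReal) _
      _ ≤ Fintype.card ι := by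
          rw [lintegral_finsetSum _ fun k _ => (hT k).ennreal_ofReal]
          refine (Finset.sum_le_sum fun k _ => h1 k).trans ?_
          simp
  have h3 : μ {ω | ∀ k, T k ω ≤ Fintype.card ι / δ}ᶜ ≤ ENNReal.ofReal δ := by
    have e : (Fintype.card ι : ENNReal) =
        ENNReal.ofReal (Fintype.card ι / δ) * ENNReal.ofReal δ := by
      rw [← ENNReal.ofReal_mul hc.le, div_mul_cancel₀ _ hδ.ne', ENNReal.ofReal_natCast]
    rw [e] at h2
    exact (ENNReal.mul_le_mul_iff_right (ENNReal.ofReal_pos.2 hc).ne' ENNReal.ofReal_ne_top).1 h2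
  rw [ENNReal.ofReal_sub _ hδ.le, ENNReal.ofReal_one, tsub_le_iff_right]
  rw [← prob_add_prob_compl (μ := μ) hms]
  exact add_le_add_right h3 _

lemma lintegral_div_le_one {Ω : Type*} [MeasurableSpace Ω] {μ : Measure Ω} {f : Ω → ℝ} {B : ℝ}
    (hB : 0 < B) (h : ∫⁻ ω, ENNReal.ofReal (f ω) ∂μ ≤ ENNReal.ofReal B) :
    ∫⁻ ω, ENNReal.ofReal (f ω / B) ∂μ ≤ 1 := by
  simp_rw [div_eq_inv_mul, ENNReal.ofReal_mul (inv_nonneg.2 hB.le)]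
  rw [lintegral_const_mul' _ _ ENNReal.ofReal_ne_top]
  refine (mul_le_mul_right h _).trans (le_of_eq ?_)
  rw [← ENNReal.ofReal_mul (inv_nonneg.2 hB.le), inv_mul_cancel₀ hB.ne', ENNReal.ofReal_one]

lemma lintegral_sum_le {Ω ι : Type*} [Fintype ι] [MeasurableSpace Ω] {μ : Measure Ω}
    {f : ι → Ω → ℝ} (hf : ∀ i, Measurable (f i)) (h0 : ∀ i ω, 0 ≤ f i ω) {B : ℝ}
    (h : ∀ i, ∫⁻ ω, ENNReal.ofReal (f i ω) ∂μ ≤ ENNReal.ofReal B) :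
    ∫⁻ ω, ENNReal.ofReal (∑ i, f i ω) ∂μ ≤ ENNReal.ofReal (Fintype.card ι * B) := by
  simp_rw [ENNReal.ofReal_sum_of_nonneg fun i _ => h0 i _]
  rw [lintegral_finsetSum _ fun i _ => (hf i).ennreal_ofReal]
  refine (Finset.sum_le_sum fun i _ => h i).trans (le_of_eq ?_)
  rw [ENNReal.ofReal_mul (Nat.cast_nonneg _), ENNReal.ofReal_natCast]
  simp

/-! ### The main theorem -/

/-- Markov bounds for all the random quantities of the initialization at once. -/
lemma exists_good_init {X : Fin n → EuclideanSpace ℝ (Fin d)} {x : EuclideanSpace ℝ (Fin d)}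
    {κ R δ : ℝ} (hn : 0 < n) (hm : 0 < m) (hX : ∀ i, ‖X i‖ = 1) (hx : ‖x‖ = 1) (hκ : 0 < κ)
    (hR : 0 < R) (hδ : 0 < δ) :
    ∃ S : Set (Weights m d × (Fin m → ℝ)), MeasurableSet S ∧
      ENNReal.ofReal (1 - δ) ≤ initLaw m d κ S ∧ ∀ θ ∈ S, (∀ r, |θ.2 r| = 1) ∧
        ∑ i, network θ.2 θ.1 (X i) ^ 2 ≤ 6 / δ * (n * κ ^ 2) ∧
        network θ.2 θ.1 x ^ 2 ≤ 6 / δ * κ ^ 2 ∧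
        ∑ i, flipFrac R θ.1 (X i) ≤ 6 / δ * (n * (R / κ)) ∧
        flipFrac R θ.1 x ≤ 6 / δ * (R / κ) ∧
        ∑ i, ∑ j, (empKernel (act θ.1 (X i)) (act θ.1 (X j)) (X i) (X j) - ntk (X i) (X j)) ^ 2
          ≤ 6 / δ * (n * (n * (1 / m))) ∧
        ∑ i, (empKernel (act θ.1 x) (act θ.1 (X i)) x (X i) - ntk x (X i)) ^ 2
          ≤ 6 / δ * (n * (1 / m)) := by
  have hn' : (0 : ℝ) < n := Nat.cast_pos.2 hn
  have hm' : (0 : ℝ) < m := Nat.cast_pos.2 hm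
  set D : EuclideanSpace ℝ (Fin d) → EuclideanSpace ℝ (Fin d) → Weights m d × (Fin m → ℝ) → ℝ :=
    fun u v θ => (empKernel (act θ.1 u) (act θ.1 v) u v - ntk u v) ^ 2 with hD
  have hDm : ∀ u v, Measurable (D u v) := fun u v =>
    (((measurable_empKernel u v).comp measurable_fst).sub_const _).pow_const 2
  have hDi : ∀ u v, ‖u‖ = 1 → ‖v‖ = 1 →
      ∫⁻ θ, ENNReal.ofReal (D u v θ) ∂(initLaw m d κ) ≤ ENNReal.ofReal (1 / m) :=
    fun u v hu hv => lintegral_empKernel_sub_sq_le hu hv hκ hm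
  set p : EuclideanSpace ℝ (Fin d) → Weights m d × (Fin m → ℝ) → ℝ :=
    fun u θ => flipFrac R θ.1 u with hp
  have hpm : ∀ u, Measurable (p u) := fun u => (measurable_flipFrac R u).comp measurable_fst
  set f : EuclideanSpace ℝ (Fin d) → Weights m d × (Fin m → ℝ) → ℝ :=
    fun u θ => network θ.2 θ.1 u ^ 2 with hf
  have hfm : ∀ u, Measurable (f u) := fun u => (measurable_network u).pow_const 2
  have hsum : ∀ {g : Fin n → Weights m d × (Fin m → ℝ) → ℝ} {B : ℝ}, (∀ i, Measurable (g i)) →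
      (∀ i θ, 0 ≤ g i θ) →
      (∀ i, ∫⁻ θ, ENNReal.ofReal (g i θ) ∂(initLaw m d κ) ≤ ENNReal.ofReal B) →
      ∫⁻ θ, ENNReal.ofReal (∑ i, g i θ) ∂(initLaw m d κ) ≤ ENNReal.ofReal (n * B) :=
    fun h1 h2 h3 => by simpa using lintegral_sum_le h1 h2 h3
  set T : Fin 6 → Weights m d × (Fin m → ℝ) → ℝ :=
    ![fun θ => (∑ i, f (X i) θ) / (n * κ ^ 2), fun θ => f x θ / κ ^ 2,
      fun θ => (∑ i, p (X i) θ) / (n * (R / κ)), fun θ => p x θ / (R / κ),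
      fun θ => (∑ i, ∑ j, D (X i) (X j) θ) / (n * (n * (1 / m))),
      fun θ => (∑ i, D x (X i) θ) / (n * (1 / m))] with hT
  have hTm : ∀ k, Measurable (T k) := by
    rw [hT]
    simp only [Fin.forall_fin_succ, Matrix.cons_val_zero, Matrix.cons_val_succ, IsEmpty.forall_iff,
      and_true]
    exact ⟨(Finset.measurable_sum _ fun i _ => hfm _).div_const _, (hfm x).div_const _,
      (Finset.measurable_sum _ fun i _ => hpm _).div_const _, (hpm x).div_const _,
      (Finset.measurable_sum _ fun i _ => Finset.measurable_sum _ fun j _ => hDm _ _).div_const _,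
      (Finset.measurable_sum _ fun i _ => hDm _ _).div_const _⟩
  have hTi : ∀ k, ∫⁻ θ, ENNReal.ofReal (T k θ) ∂(initLaw m d κ) ≤ 1 := by
    rw [hT]
    simp only [Fin.forall_fin_succ, Matrix.cons_val_zero, Matrix.cons_val_succ, IsEmpty.forall_iff,
      and_true]
    refine ⟨lintegral_div_le_one (by positivity) (hsum (fun i => hfm _) (fun i θ => sq_nonneg _)
        fun i => lintegral_network_sq_le (hX i) κ),
      lintegral_div_le_one (by positivity) (lintegral_network_sq_le hx κ),
      lintegral_div_le_one (by positivity) (hsum (fun i => hpm _)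
        (fun i θ => flipFrac_nonneg _ _ _) fun i => lintegral_flipFrac_le (hX i) hκ R),
      lintegral_div_le_one (by positivity) (lintegral_flipFrac_le hx hκ R),
      lintegral_div_le_one (by positivity) (hsum
        (fun i => Finset.measurable_sum _ fun j _ => hDm _ _)
        (fun i θ => Finset.sum_nonneg fun j _ => sq_nonneg _) fun i =>
          hsum (fun j => hDm _ _) (fun j θ => sq_nonneg _) fun j => hDi _ _ (hX i) (hX j)),
      lintegral_div_le_one (by positivity) (hsum (fun j => hDm _ _) (fun j θ => sq_nonneg _)
        fun j => hDi _ _ hx (hX j))⟩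
  have hmk := exists_event_of_lintegral_le_one hTm hTi hδ
  simp only [Fintype.card_fin, Nat.cast_ofNat] at hmk
  have hsgn : MeasurableSet {θ : Weights m d × (Fin m → ℝ) | ∀ r, |θ.2 r| = 1} := by
    rw [Set.ofPred_forall]
    exact MeasurableSet.iInter fun r => measurableSet_eq_fun (by fun_prop) (by fun_prop)
  have hev : MeasurableSet {θ | ∀ k, T k θ ≤ 6 / δ} := by
    rw [Set.ofPred_forall]
    exact MeasurableSet.iInter fun k => measurableSet_le (hTm k) measurable_const
  refine ⟨_, hsgn.inter hev, hmk.trans (le_of_eq (measure_congr ?_)), fun θ hθ => ⟨hθ.1, ?_⟩⟩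
  · filter_upwards [ae_abs_signs_initLaw m d κ] with θ hθ
    exact propext ⟨fun h => ⟨hθ, h⟩, fun h => h.2⟩
  · have h := hθ.2
    simp only [Set.mem_ofPred_eq, hT, Fin.forall_fin_succ, Matrix.cons_val_zero,
      Matrix.cons_val_succ, IsEmpty.forall_iff, and_true] at h
    obtain ⟨h0, h1, h2, h3, h4, h5⟩ := h
    exact ⟨(div_le_iff₀ (by positivity)).1 h0, (div_le_iff₀ (by positivity)).1 h1,
      (div_le_iff₀ (by positivity)).1 h2, (div_le_iff₀ (by positivity)).1 h3,
      (div_le_iff₀ (by positivity)).1 h4, (div_le_iff₀ (by positivity)).1 h5⟩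

lemma error_budget_le {N l q ε G c A F Fx P Px E Ex : ℝ} (hN : 1 ≤ N) (hl : 0 < l) (hl1 : l ≤ 1)
    (hq : 0 < q) (hq1 : q ≤ 1) (hε : 0 < ε) (hG : 0 < G) (hc : 0 < c)
    (hA : A = 4 * N / (q * l)) (hNF : N + F ≤ 4 * N / q)
    (hFx : Fx ≤ 3 * c * ε * l) (hF : F ≤ 3 * c * ε * l) (hPx0 : 0 ≤ Px) (hP : P = N ^ 2 * Px)
    (hPx : N ^ 4 * Px ≤ 24 * G * ε * q * l ^ 2) (hEx0 : 0 ≤ Ex)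
    (hE : E ≤ 3 * G * ε * q * l ^ 2) (hEx : Ex ≤ 3 * G * ε * q * l) :
    Fx + A * Px + (Ex + (P + N ^ 2 * Px)) * ((N + F) / (l * N)) +
      N * ((F + A * P + (E + 2 * N ^ 2 * P) * (N / (l * N))) / (l * N)) ≤
        (6 * c + 447 * G) * ε := by
  have hN0 : 0 < N := by linarith
  set B := 24 * G * ε * q * l ^ 2 with hB
  have hpow : ∀ k ≤ 4, N ^ k * Px ≤ B := fun k hk =>
    (mul_le_mul_of_nonneg_right (pow_le_pow_right₀ hN hk) hPx0).trans hPx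
  have h1 : A * Px ≤ 96 * G * ε := by
    have e : A * Px = 4 / (q * l) * (N ^ 1 * Px) := by rw [hA]; ring
    rw [e]
    calc _ ≤ 4 / (q * l) * B := mul_le_mul_of_nonneg_left (hpow 1 (by norm_num)) (by positivity)
      _ = 96 * G * ε * l := by rw [hB]; field_simp; ring
      _ ≤ 96 * G * ε := mul_le_of_le_one_right (by positivity) hl1
  have h2 : (Ex + (P + N ^ 2 * Px)) * ((N + F) / (l * N)) ≤ 204 * G * ε := by
    have h3 : (N + F) / (l * N) ≤ 4 / (q * l) := by
      rw [div_le_iff₀ (by positivity)]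
      refine hNF.trans (le_of_eq ?_)
      field_simp
    have h4 := hpow 2 (by norm_num)
    calc _ ≤ (3 * G * ε * q * l + (B + B)) * (4 / (q * l)) := by
          refine (mul_le_mul_of_nonneg_left h3 (by rw [hP]; positivity)).trans
            (mul_le_mul_of_nonneg_right ?_ (by positivity))
          rw [hP]
          linarith
      _ = 12 * G * ε + 192 * G * ε * l := by rw [hB]; field_simp; ring
      _ ≤ _ := by linarith [mul_le_of_le_one_right (by positivity : 0 ≤ 192 * G * ε) hl1]
  have h3 : N * ((F + A * P + (E + 2 * N ^ 2 * P) * (N / (l * N))) / (l * N)) ≤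
      (3 * c + 147 * G) * ε := by
    have h5 : A * P ≤ 96 * G * ε * l := by
      have e : A * P = 4 / (q * l) * (N ^ 3 * Px) := by rw [hA, hP]; ring
      rw [e]
      calc _ ≤ 4 / (q * l) * B := mul_le_mul_of_nonneg_left (hpow 3 (by norm_num)) (by positivity)
        _ = 96 * G * ε * l := by rw [hB]; field_simp; ring
    have h6 : (E + 2 * N ^ 2 * P) * (N / (l * N)) ≤ 51 * G * ε * l := by
      have e : N / (l * N) = 1 / l := by field_simp
      have e2 : 2 * N ^ 2 * P = 2 * (N ^ 4 * Px) := by rw [hP]; ring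
      rw [e, e2, mul_one_div, div_le_iff₀ hl]
      have h7 : 51 * G * ε * l ^ 2 * q ≤ 51 * G * ε * l ^ 2 :=
        mul_le_of_le_one_right (by positivity) hq1
      linarith
    have e : N * ((F + A * P + (E + 2 * N ^ 2 * P) * (N / (l * N))) / (l * N)) =
        (F + A * P + (E + 2 * N ^ 2 * P) * (N / (l * N))) / l := by field_simp
    rw [e, div_le_iff₀ hl]
    linarith
  have h4 : 3 * c * ε * l ≤ 3 * c * ε := mul_le_of_le_one_right (by positivity) hl1
  linarith

end WideNet

open WideNet in
theorem theorem1 (c₁ c₂ : ℝ) (hc₁ : 0 < c₁) (hc₂ : 0 < c₂) :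
    ∃ C : ℝ, 0 < C ∧
      ∀ (d n m : ℕ) (X : Fin n → EuclideanSpace ℝ (Fin d)) (y : Fin n → ℝ)
        (lam κ ε δ : ℝ),
        (∀ i, ‖X i‖ = 1) → (∀ i, |y i| ≤ 1) →
        0 < lam → lam < Real.sqrt n →
        0 < ε → 0 < δ → δ < 1 →
        0 < κ → κ ≤ 1 →
        κ ≤ c₁ * (Real.sqrt δ * lam * ε / n) →
        c₂ * ((n : ℝ) ^ 8 / (κ ^ 2 * ε ^ 2 * δ ^ 4 * lam ^ 6)) ≤ (m : ℝ) →
        ∀ x : EuclideanSpace ℝ (Fin d), ‖x‖ = 1 →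
          ∃ S : Set (WideNet.Weights m d × (Fin m → ℝ)),
            MeasurableSet S ∧
            ENNReal.ofReal (1 - δ) ≤ WideNet.initLaw m d κ S ∧
            ∀ θ ∈ S,
              (∃ W : ℝ → WideNet.Weights m d,
                WideNet.IsGradientFlow X y lam θ.2 θ.1 W) ∧
              ∀ W : ℝ → WideNet.Weights m d,
                WideNet.IsGradientFlow X y lam θ.2 θ.1 W →
                ∃ f : ℝ,
                  Tendsto (fun t => WideNet.network θ.2 (W t) x) atTop (𝓝 f) ∧
                  |f - WideNet.ntkPredictor X y lam x| ≤ C * ε := by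
  refine ⟨6 * c₁ + 447 * (1 / Real.sqrt c₂), by positivity, ?_⟩
  intro d n m X y lam κ ε δ hX hy hlam hlamn hε hδ hδ1 hκ hκ1 hκc hmc x hx
  have hn : 0 < n := Nat.pos_of_ne_zero fun h => by
    rw [h, Nat.cast_zero, Real.sqrt_zero] at hlamn
    linarith
  have hn' : (0 : ℝ) < n := Nat.cast_pos.2 hn
  have hm' : (0 : ℝ) < m := lt_of_lt_of_le (by positivity) hmc
  have hm : 0 < m := Nat.cast_pos.1 hm'
  set N := Real.sqrt n with hN
  set q := Real.sqrt δ with hq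
  set s := Real.sqrt m with hs
  set G := 1 / Real.sqrt c₂ with hG
  have hN1 : 1 ≤ N := Real.one_le_sqrt.2 (Nat.one_le_cast.2 hn)
  have hN0 : 0 < N := by linarith
  have hq0 : 0 < q := Real.sqrt_pos.2 hδ
  have hq1 : q ≤ 1 := Real.sqrt_le_one.2 hδ1.le
  have hs0 : 0 < s := Real.sqrt_pos.2 hm'
  have hG0 : 0 < G := by positivity
  have hnN : (n : ℝ) = N ^ 2 := (Real.sq_sqrt hn'.le).symm
  have hδq : δ = q ^ 2 := (Real.sq_sqrt hδ.le).symm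
  have hms : (m : ℝ) = s ^ 2 := (Real.sq_sqrt hm'.le).symm
  set l := lam / N with hl
  have hl0 : 0 < l := by positivity
  have hl1 : l ≤ 1 := (div_le_one hN0).2 hlamn.le
  have hlam_eq : lam = l * N := by rw [hl]; field_simp
  have hκq : κ / q ≤ c₁ * ε * l := by
    rw [div_le_iff₀ hq0]
    refine hκc.trans ?_
    rw [hnN, hlam_eq]
    have e : c₁ * (q * (l * N) * ε / N ^ 2) = c₁ * ε * l * q / N := by field_simp
    rw [e]
    exact div_le_self (by positivity) hN1
  have hκqN : κ * N / q ≤ c₁ * ε * l := by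
    rw [div_le_iff₀ hq0]
    refine (mul_le_mul_of_nonneg_right hκc hN0.le).trans (le_of_eq ?_)
    rw [hnN, hlam_eq]
    field_simp
  have hwidth : N ^ 5 / s ≤ G * κ * ε * q ^ 4 * l ^ 3 := by
    rw [div_le_iff₀ hs0]
    have h1 : N ^ 5 / (G * κ * ε * q ^ 4 * l ^ 3) ≤ s := by
      refine Real.le_sqrt_of_sq_le (le_trans (le_of_eq ?_) hmc)
      rw [hnN, hδq, hlam_eq, hG]
      have h2 : c₂ = Real.sqrt c₂ ^ 2 := (Real.sq_sqrt hc₂.le).symm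
      have h3 : 0 < Real.sqrt c₂ := Real.sqrt_pos.2 hc₂
      generalize Real.sqrt c₂ = b at h2 h3
      rw [h2]
      field_simp
    rw [div_le_iff₀ (by positivity)] at h1
    linarith
  set R := 4 * N / (q * l) / s with hR
  have hR0 : 0 < R := by positivity
  have hsR : s * R = 4 * N / (q * l) := by rw [hR]; field_simp
  obtain ⟨S, hS, hSp, hgood⟩ := exists_good_init (κ := κ) hn hm hX hx hκ hR0 hδ
  refine ⟨S, hS, hSp, fun θ hθ => ⟨exists_isGradientFlow X y lam θ.2 θ.1, fun W hW => ?_⟩⟩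
  obtain ⟨ha, hf, hfx, hp, hpx, hD, hDx⟩ := hgood θ hθ
  obtain ⟨V, hV⟩ := hW.exists_tendsto hlam
  obtain ⟨hloss, hstat⟩ := hW.stationary_of_tendsto hlam hV
  refine ⟨network θ.2 V x, ((continuous_network θ.2 x).tendsto V).comp hV, ?_⟩
  have hNF : N + 3 * κ * N / q ≤ 4 * N / q := by
    have h1 : N ≤ N / q := by
      rw [le_div_iff₀ hq0]
      exact mul_le_of_le_one_right hN0.le hq1
    have h2 : 3 * κ * N / q ≤ 3 * N / q := by
      refine div_le_div_of_nonneg_right ?_ hq0.le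
      nlinarith
    have h3 : 4 * N / q = N / q + 3 * N / q := by ring
    linarith
  have hkey := abs_network_sub_ntkPredictor_le (R := R) (F := 3 * κ * N / q) (Fx := 3 * κ / q)
    (P := N ^ 2 * (6 / q ^ 2 * (R / κ))) (Px := 6 / q ^ 2 * (R / κ)) (E := 3 * N ^ 2 / (q * s))
    (Ex := 3 * N / (q * s)) hm hlam hX hx hy ha (by positivity) (by positivity) hR0.le
    (by
      refine le_of_pow_le_pow_left₀ two_ne_zero (by positivity) ?_
      rw [EuclideanSpace.real_norm_sq_eq]
      refine hf.trans ?_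
      rw [hδq, hnN]
      have e : (3 * κ * N / q) ^ 2 = 9 / q ^ 2 * (N ^ 2 * κ ^ 2) := by ring
      rw [e]
      gcongr
      norm_num)
    (by
      refine abs_le_of_sq_le_sq (hfx.trans ?_) (by positivity)
      rw [hδq]
      have e : (3 * κ / q) ^ 2 = 9 / q ^ 2 * κ ^ 2 := by ring
      rw [e]
      gcongr
      norm_num)
    (by
      rw [hsR, hlam_eq]
      have e : l * N * (4 * N / (q * l)) = N * (4 * N / q) := by field_simp
      rw [e]
      exact mul_le_mul_of_nonneg_left hNF hN0.le)
    (hp.trans (le_of_eq (by rw [hδq, hnN]; ring))) (hpx.trans (le_of_eq (by rw [hδq])))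
    (hD.trans (by
      rw [hδq, hnN, hms]
      have e : (3 * N ^ 2 / (q * s)) ^ 2 = 9 / q ^ 2 * (N ^ 2 * (N ^ 2 * (1 / s ^ 2))) := by
        field_simp
        norm_num
      rw [e]
      gcongr
      norm_num))
    (hDx.trans (by
      rw [hδq, hnN, hms]
      have e : (3 * N / (q * s)) ^ 2 = 9 / q ^ 2 * (N ^ 2 * (1 / s ^ 2)) := by
        field_simp
        norm_num
      rw [e]
      gcongr
      norm_num))
    hloss hstat
  refine hkey.trans ?_
  rw [← hN, ← hs, hsR, hnN, hlam_eq]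
  have hEs : ∀ k ≤ 5, 3 * N ^ k / (q * s) ≤ 3 * G * ε * q ^ 3 * l ^ 3 := fun k hk => by
    have h1 : 3 * N ^ k / (q * s) ≤ 3 / q * (N ^ 5 / s) := by
      have e : 3 * N ^ k / (q * s) = 3 / q * (N ^ k / s) := by field_simp
      rw [e]
      gcongr
    refine h1.trans ((mul_le_mul_of_nonneg_left hwidth (by positivity)).trans ?_)
    have e : 3 / q * (G * κ * ε * q ^ 4 * l ^ 3) = 3 * G * ε * q ^ 3 * l ^ 3 * κ := by field_simp
    rw [e]
    exact mul_le_of_le_one_right (by positivity) hκ1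
  have hq3 : q ^ 3 ≤ q := pow_le_of_le_one hq0.le hq1 three_ne_zero
  refine error_budget_le hN1 hl0 hl1 hq0 hq1 hε hG0 hc₁ rfl hNF ?_ ?_ (by positivity) rfl ?_
    (by positivity) ((hEs 2 (by norm_num)).trans ?_) ?_
  · rw [mul_div_assoc]
    linarith
  · rw [mul_assoc, mul_div_assoc]
    linarith
  · have e : N ^ 4 * (6 / q ^ 2 * (R / κ)) = 24 / (q ^ 3 * l * κ) * (N ^ 5 / s) := by
      rw [hR]
      field_simp
      norm_num
    rw [e]
    refine (mul_le_mul_of_nonneg_left hwidth (by positivity)).trans (le_of_eq ?_)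
    field_simp
  · have hl3 : l ^ 3 ≤ l ^ 2 := pow_le_pow_of_le_one hl0.le hl1 (by norm_num)
    gcongr
  · have h1 := hEs 1 (by norm_num)
    rw [pow_one] at h1
    refine h1.trans ?_
    have hl3 : l ^ 3 ≤ l := pow_le_of_le_one hl0.le hl1 three_ne_zero
    gcongr
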